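/- A bidirected graph $B=(G,\sigma)$ is a loopless multigraph $G=(V,E)$ together with a sign $\sigma(e,u)\in\{+,-\}$ for every edge $e$ and each endpoint $u$ of $e$. An orientation of an edge $e$ with endpoints $u,v$ is a triple $\vec e=(e,u,v)$, with tail $u$ and head $v$ (so every edge has exactly two orientations). A trail is a sequence $v_0\vec e_1v_1\vec e_2\dots\vec e_\ell v_\ell$ $(\ell\ge 0)$ of vertices and oriented edges such that $\vec e_i$ has tail $v_{i-1}$ and head $v_i$, the edges $e_1,\dots,e_\ell$ are pairwise distinct, and $\sigma(e_{i+1},v_i)=-\sigma(e_i,v_i)$ for $1\le i<\ell$. It is an $x$–$y$ trail if $v_0=x$ and $v_\ell=y$. Two trails are edge-disjoint if no edge has an orientation in both of them. Fix a root $r\in V$. An $r$-trail is a trail with $v_0=r$ and $v_i\ne r$ for $0<i<\ell$; an $r$–$\vec e$ trail is an $r$-trail with last edge $\vec e_\ell=\vec e$. Call $B$ edge-clean if for every edge $e$ incident with $r$ there is exactly one orientation $\vec e$ of $e$ for which an $r$–$\vec e$ trail exists. For $X\subseteq V\setminus\{r\}$ let $\delta^{\mathsf{trail}}_{r,B}(X)$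 be the set of edges $e$ that have an orientation $\vec e$ with head in $X$ and tail not in $X$ such that an $r$–$\vec e$ trail exists. **Theorem.** Let $B$ be an edge-clean bidirected graph rooted at $r$ and let $x\in V\setminus\{r\}$. Then the maximum number $\lambda^{\mathrm{trail}}_B(r,x)$ of pairwise edge-disjoint $r$–$x$ trails satisfies $$\lambda^{\mathrm{trail}}_B(r,x)=\min\bigl\{\,|\delta^{\mathsf{trail}}_{r,B}(X)| : x\in X\subseteq V\setminus\{r\}\,\bigr\}.$$ ($B$ may be infinite; numbers of trails and edges are counted in $\mathbb N\cup\{\infty\}$, and both the maximum and the minimum are attained.) -/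

import Mathlib

/-- A bidirected graph: a loopless multigraph (with vertices in `α` and edges in `β`) together
with a sign in `{+1, -1} = ℤˣ` for every half-edge `(e, u)`, `u` an endpoint of `e`. -/
structure BidirectedGraph (α β : Type*) where
  graph : Graph α β
  loopless : graph.Loopless
  sign : {h : β × α // graph.Inc h.1 h.2} → ℤˣ

namespace BidirectedGraph

variable {α β : Type*}

/-- An oriented edge `(e, u, v)`: an edge with its two endpoints in a chosen order. -/
@[ext]
structure OrientedEdge (B : BidirectedGraph α β) where
  edge : β
  tail : α
  head : α
  isLink : B.graph.IsLink edge tail head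

namespace OrientedEdge

variable {B : BidirectedGraph α β}

/-- The sign of the underlying edge at the tail. -/
def tailSign (e : B.OrientedEdge) : ℤˣ :=
  B.sign ⟨(e.edge, e.tail), e.isLink.inc_left⟩

/-- The sign of the underlying edge at the head. -/
def headSign (e : B.OrientedEdge) : ℤˣ :=
  B.sign ⟨(e.edge, e.head), e.isLink.inc_right⟩

end OrientedEdge

/-- A trail `v₀ e₁ v₁ … e_ℓ v_ℓ`, given by `v₀` and the list of oriented edges `e₁, …, e_ℓ`;
the further vertices are the heads `v_i` of the `e_i`. The underlying edges are distinct, and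
at each internal vertex the two consecutive edges have opposite signs. -/
@[ext]
structure Trail (B : BidirectedGraph α β) where
  init : α
  init_mem : init ∈ B.graph.vertexSet
  edges : List B.OrientedEdge
  tail_first : ∀ e ∈ edges.head?, e.tail = init
  chain : edges.IsChain fun e f => f.tail = e.head ∧ f.tailSign = -e.headSign
  nodup : (edges.map OrientedEdge.edge).Nodup

namespace Trail

variable {B : BidirectedGraph α β}

/-- The terminal vertex `v_ℓ`. -/
def term (T : B.Trail) : α :=
  (T.edges.getLast?.map OrientedEdge.head).getD T.init

/-- `E(T)`: the edges that have an orientation appearing in `T`. -/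
def edgeSet (T : B.Trail) : Set β :=
  {e | ∃ o ∈ T.edges, o.edge = e}

/-- An `x`–`y` trail. -/
def IsFromTo (T : B.Trail) (x y : α) : Prop :=
  T.init = x ∧ T.term = y

/-- An `r`-trail: it starts in `r` and none of its internal vertices `v₁, …, v_{ℓ-1}` is `r`. -/
def IsRooted (T : B.Trail) (r : α) : Prop :=
  T.init = r ∧ ∀ e ∈ T.edges.dropLast, e.head ≠ r

end Trail

/-- There is an `r`-trail whose terminal edge is the oriented edge `o`. -/
def TrailReaches (B : BidirectedGraph α β) (r : α) (o : B.OrientedEdge) : Prop :=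
  ∃ T : B.Trail, T.IsRooted r ∧ T.edges.getLast? = some o

/-- The edge `e` has exactly one orientation that is the terminal edge of some `r`-trail. -/
def IsTrailDirectable (B : BidirectedGraph α β) (r : α) (e : β) : Prop :=
  ∃! o : B.OrientedEdge, o.edge = e ∧ B.TrailReaches r o

/-- Every edge incident with the root is trail-directable. -/
def EdgeClean (B : BidirectedGraph α β) (r : α) : Prop :=
  ∀ e, B.graph.Inc e r → B.IsTrailDirectable r e

/-- `δ^trail_{r,B}(X)`: the edges having an orientation with head in `X` and tail outside `X`
that is the terminal edge of some `r`-trail. -/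
def trailCut (B : BidirectedGraph α β) (r : α) (X : Set α) : Set β :=
  {e | ∃ o : B.OrientedEdge, o.edge = e ∧ o.head ∈ X ∧ o.tail ∉ X ∧ B.TrailReaches r o}

/-- A set of pairwise edge-disjoint `x`–`y` trails. -/
def IsEdgeDisjointTrails (B : BidirectedGraph α β) (x y : α) (𝒯 : Set B.Trail) : Prop :=
  (∀ T ∈ 𝒯, T.IsFromTo x y) ∧ 𝒯.Pairwise fun S T => Disjoint S.edgeSet T.edgeSet

end BidirectedGraph

/-! A trail moves through states, a state being a vertex with the sign of arrival. In a loopless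
edge-clean graph no trail from `r` returns to `r`: the first edge returning there would be reachable
in both orientations. Hence every edge of a trail from `r` is reachable in the direction of its use,
and each `r`–`x` trail uses an edge of every trail cut. This is the easy inequality
(`EdgeClean.encard_le`).

For the converse inside a finite edge set, blossoms are contracted as in Edmonds' matching
algorithm. If there is a closed walk at `r` but no closed trail, then a suitable shortest closed
walk runs along a stem, around a loop, and back along the stem (`exists_blossom`). After the last
stem edge `f`, both states at each vertex of the loop are reachable inside its vertex set `X`. So
`X` can be contracted to one vertex that is passed only by using `f`, in one direction or the other.
When no closed walk is left, the darts traversed by walks from `r` form a digraph. Undoing the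
contractions yields a barrier (`exists_barrier`): the vertices fall into single vertices and blobs,
trails from `r` change class only along the arcs of a digraph, and each blob has a unique entering
arc. Walks in the quotient digraph lift to trails, and disjoint walks enter different blobs, so
their lifts are disjoint. Menger's theorem in the quotient (`ArcFlow.menger`) then provides both the
trails and the cut (`exists_trails_and_cut`).

For infinite graphs, each finite edge set gives such a family and vertex set. If the families have
bounded size, an ultrafilter limit of the vertex sets is an optimal cut (`EdgeClean.exists_cut`).
Otherwise a maximal family is infinite (`exists_infinite_trails`), and every cut is infinite too. -/

theorem List.exists_split_of_not_pairwise {α : Type*} {R : α → α → Prop} {l : List α}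
    (h : ¬ l.Pairwise R) :
    ∃ l₁ a l₂ b l₃, l = l₁ ++ a :: (l₂ ++ b :: l₃) ∧ ¬ R a b := by
  induction l with
  | nil => simp at h
  | cons a l ih =>
    rw [List.pairwise_cons, not_and_or] at h
    rcases h with h | h
    · push Not at h
      obtain ⟨b, hb, hab⟩ := h
      obtain ⟨l₂, l₃, rfl⟩ := List.append_of_mem hb
      exact ⟨[], a, l₂, b, l₃, rfl, hab⟩
    · obtain ⟨l₁, c, l₂, b, l₃, rfl, hR⟩ := ih h
      exact ⟨a :: l₁, c, l₂, b, l₃, rfl, hR⟩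

/-! ### Dart systems, states and paths -/

/-- A system of darts (oriented edges) with a reversing map; every dart `o` has a source vertex
and a sign at its source. Bidirected graphs, possibly with loops, are of this form. -/
structure DartSystem (O V : Type*) where
  rev : O → O
  rev_rev : ∀ o, rev (rev o) = o
  src : O → V
  sgn : O → ℤˣ

namespace DartSystem

variable {O V : Type*} (S : DartSystem O V)

/-- The head of a dart. -/
def tgt (o : O) : V := S.src (S.rev o)

/-- The state `(v, s)` in which a dart arrives: at the vertex `v` with sign `s`. -/
def arr (o : O) : V × ℤˣ := (S.tgt o, S.sgn (S.rev o))

/-- The state from which a dart departs. -/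
def dep (o : O) : V × ℤˣ := (S.src o, -S.sgn o)

/-- The state with the opposite sign. -/
def opp (p : V × ℤˣ) : V × ℤˣ := (p.1, -p.2)

/-- The dart list `L` leads from the state `p` to the state `q`. -/
def Path (p : V × ℤˣ) : List O → V × ℤˣ → Prop
  | [], q => p = q
  | o :: L, q => S.dep o = p ∧ Path (S.arr o) L q

/-- The two darts belong to different edges. -/
def Apart (a b : O) : Prop := a ≠ b ∧ a ≠ S.rev b

/-- The reversed dart list. -/
def rv (L : List O) : List O := (L.map S.rev).reverse

variable {S}

@[simp] lemma opp_opp (p : V × ℤˣ) : opp (opp p) = p := by simp [opp]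

@[simp] lemma opp_fst (p : V × ℤˣ) : (opp p).1 = p.1 := rfl

lemma opp_ne (p : V × ℤˣ) : opp p ≠ p := by
  intro h
  have := congrArg Prod.snd h
  simp only [opp] at this
  rcases Int.units_eq_one_or p.2 with h | h <;> rw [h] at this <;> exact absurd this (by decide)

lemma eq_or_eq_opp {p q : V × ℤˣ} (h : p.1 = q.1) : p = q ∨ p = opp q := by
  rcases p with ⟨v, s⟩
  rcases q with ⟨u, t⟩
  simp only at h
  subst h
  rcases Int.units_eq_one_or s with h | h <;> rcases Int.units_eq_one_or t with h' | h' <;>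
    simp [opp, h, h']

@[simp] lemma dep_rev (o : O) : S.dep (S.rev o) = opp (S.arr o) := rfl

@[simp] lemma arr_rev (o : O) : S.arr (S.rev o) = opp (S.dep o) := by
  simp [arr, dep, opp, tgt, S.rev_rev]

@[simp] lemma tgt_rev (o : O) : S.tgt (S.rev o) = S.src o := by simp [tgt, S.rev_rev]

@[simp] lemma src_rev (o : O) : S.src (S.rev o) = S.tgt o := rfl

@[simp] lemma arr_fst (o : O) : (S.arr o).1 = S.tgt o := rfl

@[simp] lemma dep_fst (o : O) : (S.dep o).1 = S.src o := rfl

@[simp] lemma path_nil {p q : V × ℤˣ} : S.Path p [] q ↔ p = q := Iff.rfl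

@[simp] lemma path_cons {p q : V × ℤˣ} {o : O} {L : List O} :
    S.Path p (o :: L) q ↔ S.dep o = p ∧ S.Path (S.arr o) L q := Iff.rfl

lemma path_append {p q : V × ℤˣ} {L M : List O} :
    S.Path p (L ++ M) q ↔ ∃ m, S.Path p L m ∧ S.Path m M q := by
  induction L generalizing p with
  | nil => simp
  | cons o L ih => simp [ih, and_assoc]

lemma Path.append {p m q : V × ℤˣ} {L M : List O} (h : S.Path p L m) (h' : S.Path m M q) :
    S.Path p (L ++ M) q := path_append.2 ⟨m, h, h'⟩

lemma path_append_cons {p q : V × ℤˣ} {L M : List O} {o : O} :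
    S.Path p (L ++ o :: M) q ↔ S.Path p L (S.dep o) ∧ S.Path (S.arr o) M q := by
  rw [path_append]
  simp only [path_cons]
  exact ⟨fun ⟨m, h1, h2, h3⟩ => ⟨h2 ▸ h1, h3⟩, fun ⟨h1, h2⟩ => ⟨_, h1, rfl, h2⟩⟩

variable (S) in
@[simp] lemma rv_nil : S.rv [] = [] := rfl

@[simp] lemma rv_append (L M : List O) : S.rv (L ++ M) = S.rv M ++ S.rv L := by simp [rv]

@[simp] lemma rv_cons (o : O) (L : List O) : S.rv (o :: L) = S.rv L ++ [S.rev o] := by simp [rv]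

@[simp] lemma rv_rv (L : List O) : S.rv (S.rv L) = L := by
  induction L with
  | nil => rfl
  | cons o L ih => simp [ih, S.rev_rev]

@[simp] lemma length_rv (L : List O) : (S.rv L).length = L.length := by simp [rv]

lemma mem_rv {o : O} {L : List O} : o ∈ S.rv L ↔ S.rev o ∈ L := by
  simp only [rv, List.mem_reverse, List.mem_map]
  exact ⟨fun ⟨a, h, e⟩ => by rw [← e, S.rev_rev]; exact h, fun h => ⟨_, h, S.rev_rev o⟩⟩

lemma Path.rv {p q : V × ℤˣ} {L : List O} (h : S.Path p L q) :
    S.Path (opp q) (S.rv L) (opp p) := by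
  induction L generalizing p with
  | nil => simp only [path_nil] at h; simp [h]
  | cons o L ih =>
    obtain ⟨rfl, h⟩ := h
    rw [rv_cons]
    exact (ih h).append ⟨dep_rev o, by simp⟩

lemma Apart.symm {a b : O} (h : S.Apart a b) : S.Apart b a :=
  ⟨h.1.symm, fun e => h.2 (by rw [e, S.rev_rev])⟩

lemma not_apart {a b : O} (h : ¬ S.Apart a b) : a = b ∨ a = S.rev b := by
  unfold Apart at h; tauto

lemma Apart.rev {a b : O} (h : S.Apart a b) : S.Apart (S.rev a) (S.rev b) :=
  ⟨fun e => h.1 (by rw [← S.rev_rev a, e, S.rev_rev]),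
    fun e => h.2 (by rw [← S.rev_rev a, e, S.rev_rev])⟩

lemma pairwise_rv {L : List O} (h : L.Pairwise S.Apart) : (S.rv L).Pairwise S.Apart := by
  rw [rv, List.pairwise_reverse, List.pairwise_map]
  exact h.imp fun h => h.rev.symm

/-! ### Blossoms -/

variable (S) in
/-- A closed walk at `r` with darts in `F`. -/
def IsClosedWalk (F : Set O) (r : V) (L : List O) : Prop :=
  L ≠ [] ∧ (∀ o ∈ L, o ∈ F) ∧ ∃ p q, S.Path p L q ∧ p.1 = r ∧ q.1 = r

variable (S) in
/-- Both ends of the dart are in `X`. -/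
def Inner (X : Set V) (o : O) : Prop := S.src o ∈ X ∧ S.tgt o ∈ X

lemma Inner.rev {X : Set V} {o : O} (h : S.Inner X o) : S.Inner X (S.rev o) :=
  ⟨h.2, by rw [tgt_rev]; exact h.1⟩

lemma inner_rev {X : Set V} {o : O} : S.Inner X (S.rev o) ↔ S.Inner X o :=
  ⟨fun h => by simpa [S.rev_rev] using h.rev, Inner.rev⟩

lemma Inner.apart {X : Set V} {a b : O} (ha : S.Inner X a) (hb : ¬ S.Inner X b) : S.Apart a b :=
  ⟨fun e => hb (e ▸ ha), fun e => hb (inner_rev.1 (e ▸ ha))⟩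

variable (S) in
/-- A blossom: the dart `f` enters the vertex set `X`, and from `f` every state at a vertex of `X`
is reached by a trail inside `X`. -/
structure IsBlossom (F : Set O) (f : O) (X : Set V) : Prop where
  mem : f ∈ F
  src_notMem : S.src f ∉ X
  tgt_mem : S.tgt f ∈ X
  reach : ∀ v ∈ X, ∀ s, ∃ Z : List O, S.Path (S.arr f) Z (v, s) ∧ Z.Pairwise S.Apart ∧
    ∀ o ∈ Z, o ∈ F ∧ S.Inner X o

/-- If there is a closed walk at `r`, but no closed trail, then some blossom is reached by
a trail from `r`. -/
lemma exists_blossom {F : Set O} (hF : ∀ o ∈ F, S.rev o ∈ F) {r : V}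
    (hr : ∀ L, S.IsClosedWalk F r L → ¬ L.Pairwise S.Apart) (hw : ∃ L, S.IsClosedWalk F r L) :
    ∃ (f : O) (X : Set V) (P : List O) (p q : V × ℤˣ), S.IsBlossom F f X ∧ r ∉ X ∧
      (∃ o ∈ F, S.Inner X o) ∧ S.Path p (P ++ [f]) q ∧ p.1 = r ∧ (P ++ [f]).Pairwise S.Apart ∧
      ∀ o ∈ P ++ [f], o ∈ F ∧ S.src o ∉ X := by
  classical
  have hFrv : ∀ {L : List O}, (∀ o ∈ L, o ∈ F) → ∀ o ∈ S.rv L, o ∈ F := fun h o ho => by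
    have := hF _ (h _ (mem_rv.1 ho)); rwa [S.rev_rev] at this
  obtain ⟨N, ⟨L₀, hL₀, hN⟩, hmin⟩ : ∃ N, (∃ L, S.IsClosedWalk F r L ∧ L.length = N) ∧
      ∀ L, S.IsClosedWalk F r L → N ≤ L.length := by
    have h : ∃ N, ∃ L, S.IsClosedWalk F r L ∧ L.length = N :=
      hw.imp' (·.length) fun L h => ⟨L, h, rfl⟩
    exact ⟨Nat.find h, Nat.find_spec h, fun L hL => Nat.find_min' h ⟨L, hL, rfl⟩⟩
  -- Among the shortest closed walks, one is chosen whose stem `P`, traversed forwards at the start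
  -- and backwards at the end, is longest.
  let Q : ℕ → Prop := fun n => ∃ P K, S.IsClosedWalk F r (P ++ K ++ S.rv P) ∧
    (P ++ K ++ S.rv P).length = N ∧ P.length = n
  have hQ0 : Q 0 := ⟨[], L₀, by simpa using hL₀, by simpa using hN, rfl⟩
  have hQb : ∀ n, Q n → n ≤ N := by
    rintro n ⟨P, K, -, h, rfl⟩
    simp only [List.length_append] at h
    omega
  obtain ⟨P, K, hc, hlen, hPn⟩ := Nat.findGreatest_spec (P := Q) (Nat.zero_le N) hQ0
  have hmax : ∀ P' K', S.IsClosedWalk F r (P' ++ K' ++ S.rv P') →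
      (P' ++ K' ++ S.rv P').length = N → P'.length ≤ P.length := fun P' K' h1 h2 => by
    rw [hPn]
    exact Nat.le_findGreatest (hQb _ ⟨P', K', h1, h2, rfl⟩) ⟨P', K', h1, h2, rfl⟩
  clear hPn hQb hQ0
  simp only [List.length_append, length_rv] at hlen
  obtain ⟨hne, hmem, p, q, hpath, hp, hq⟩ := hc
  have hPF : ∀ o ∈ P, o ∈ F := fun o ho => hmem o (by simp [ho])
  have hKF : ∀ o ∈ K, o ∈ F := fun o ho => hmem o (by simp [ho])
  have short : ∀ {L : List O} {p q : V × ℤˣ}, S.Path p L q → p.1 = r → q.1 = r →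
      (∀ o ∈ L, o ∈ F) → L ≠ [] → L.length < 2 * P.length + K.length → False :=
    fun hL hp hq hLF hL0 hlt => by
      have := hmin _ ⟨hL0, hLF, _, _, hL, hp, hq⟩
      omega
  have hpw : (P ++ K).Pairwise S.Apart := by
    by_contra hcon
    obtain ⟨L₁, a, L₂, b, L₃, hL, hab⟩ := List.exists_split_of_not_pairwise hcon
    have hLlen := congrArg List.length hL
    simp only [List.length_append, List.length_cons] at hLlen
    have hLF : ∀ o ∈ L₁ ++ a :: (L₂ ++ b :: L₃), o ∈ F := by
      rw [← hL]; intro o ho; exact hmem o (by simp at ho ⊢; tauto)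
    rw [hL] at hpath
    simp only [List.append_assoc, List.cons_append] at hpath
    rw [path_append_cons, path_append_cons] at hpath
    obtain ⟨h1, h2, h3⟩ := hpath
    have hF1 : ∀ o ∈ L₁, o ∈ F := fun o ho => hLF o (by simp [ho])
    have hF2 : ∀ o ∈ L₂, o ∈ F := fun o ho => hLF o (by simp [ho])
    have hF3 : ∀ o ∈ L₃, o ∈ F := fun o ho => hLF o (by simp [ho])
    have hFa : a ∈ F := hLF a (by simp)
    have hFb : b ∈ F := hLF b (by simp)
    rcases not_apart hab with rfl | rfl
    · refine short (path_append_cons.2 ⟨h1, h3⟩) hp hq ?_ (by simp) ?_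
      · simp only [List.mem_append, List.mem_cons]
        rintro o (ho | rfl | ho | ho)
        exacts [hF1 o ho, hFa, hF3 o ho, hFrv hPF o ho]
      · simp; omega
    · have h5 : S.Path p (L₁ ++ S.rev b :: (L₂ ++ b :: S.rv L₁)) (opp p) := by
        rw [path_append_cons, path_append_cons]
        refine ⟨h1, h2, ?_⟩
        have := h1.rv
        simpa using this
      have h5F : ∀ o ∈ L₁ ++ S.rev b :: (L₂ ++ b :: S.rv L₁), o ∈ F := by
        simp only [List.mem_append, List.mem_cons]
        rintro o (ho | rfl | ho | rfl | ho)
        exacts [hF1 o ho, hFa, hF2 o ho, hFb, hFrv hF1 o ho]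
      -- An edge is used in both directions, so either side of the walk can be replaced by the
      -- mirror image of the other. If the sides differ in length, mirroring the shorter one gives a
      -- shorter closed walk; if they are equal, it gives a shortest one with a longer stem.
      rcases lt_trichotomy L₁.length (L₃.length + P.length) with h | h | h
      · exact short h5 hp hp h5F (by simp) (by simp; omega)
      · have := hmax (L₁ ++ [S.rev b]) L₂ (by
          have e : L₁ ++ [S.rev b] ++ L₂ ++ S.rv (L₁ ++ [S.rev b]) =
            L₁ ++ S.rev b :: (L₂ ++ b :: S.rv L₁) := by simp [S.rev_rev]
          rw [e]
          exact ⟨by simp, h5F, _, _, h5, hp, hp⟩) (by simp; omega)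
        simp at this
        omega
      · have h6 := h3.rv
        refine short (h6.append (M := S.rev b :: (L₂ ++ b :: (L₃ ++ S.rv P))) ?_) hq hq ?_
          (by simp) (by simp; omega)
        · exact ⟨by simp, path_append_cons.2 ⟨h2, h3⟩⟩
        · simp only [List.mem_append, List.mem_cons, rv_append, rv_rv]
          rintro o ((ho | ho) | rfl | ho | rfl | ho | ho)
          exacts [hPF o ho, hFrv hF3 o ho, hFa, hF2 o ho, hFb, hF3 o ho, hFrv hPF o ho]
  rcases List.eq_nil_or_concat' P with rfl | ⟨P₀, f, rfl⟩
  · exact absurd (by simpa using hpw) (hr _ ⟨by simpa using hne, by simpa using hKF, p, q,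
      by simpa using hpath, hp, hq⟩)
  rw [List.append_assoc, path_append] at hpath
  obtain ⟨m, hP, hKP⟩ := hpath
  have hm : m = S.arr f := by
    obtain ⟨-, h⟩ := path_append_cons.1 hP
    exact h.symm
  subst hm
  rw [rv_append, rv_cons, rv_nil, List.nil_append, List.singleton_append, path_append_cons,
    dep_rev] at hKP
  obtain ⟨hK, -⟩ := hKP
  have hKne : K ≠ [] := by
    rintro rfl
    exact opp_ne _ (path_nil.1 hK).symm
  have split : ∀ k ∈ K, ∃ K₁ K₂, K = K₁ ++ k :: K₂ ∧ S.Path (S.arr f) K₁ (S.dep k) ∧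
      S.Path (S.arr k) K₂ (opp (S.arr f)) := fun k hk => by
    obtain ⟨K₁, K₂, rfl⟩ := List.append_of_mem hk
    exact ⟨K₁, K₂, rfl, path_append_cons.1 hK⟩
  have hfX : ∃ k ∈ K, S.src k = S.tgt f := by
    cases K with
    | nil => exact absurd rfl hKne
    | cons k K => exact ⟨k, by simp, congrArg Prod.fst hK.1⟩
  have hKX : ∀ k ∈ K, S.Inner {v | ∃ k ∈ K, S.src k = v} k := by
    refine fun k hk => ⟨⟨k, hk, rfl⟩, ?_⟩
    obtain ⟨K₁, K₂, e, -, h⟩ := split k hk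
    cases K₂ with
    | nil =>
      have := congrArg Prod.fst (path_nil.1 h)
      simp only [arr_fst, opp_fst] at this
      rw [this]
      exact hfX
    | cons l K₂ => exact ⟨l, by simp [e], congrArg Prod.fst h.1⟩
  have hKpw : K.Pairwise S.Apart := (List.pairwise_append.1 hpw).2.1
  -- A stem dart starting on the loop permits a shortcut: if its state agrees with that of `k`,
  -- switch from the stem to the rest of the loop; if the states are opposite, switch from the loop
  -- back onto the reversed stem.
  have hPX : ∀ o ∈ P₀ ++ [f], ¬ ∃ k ∈ K, S.src k = S.src o := by
    rintro o ho ⟨k, hk, hko⟩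
    obtain ⟨K₁, K₂, e, h1, h2⟩ := split k hk
    obtain ⟨P₁, P₂, e'⟩ := List.append_of_mem ho
    have hP' := hP
    rw [e', path_append_cons] at hP'
    have hK1F : ∀ o ∈ K₁, o ∈ F := fun o ho => hKF o (by simp [e, ho])
    have hK2F : ∀ o ∈ K₂, o ∈ F := fun o ho => hKF o (by simp [e, ho])
    have hP1F : ∀ o ∈ P₁, o ∈ F := fun o ho => hPF o (by rw [e']; simp [ho])
    have l1 := congrArg List.length e
    have l2 := congrArg List.length e'
    simp only [List.length_append, List.length_cons, List.length_nil] at l1 l2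
    rcases eq_or_eq_opp (p := S.dep k) (q := S.dep o) hko with h | h
    · refine short (L := P₁ ++ k :: (K₂ ++ S.rv (P₀ ++ [f]))) (q := opp p) (path_append_cons.2
        ⟨h ▸ hP'.1, h2.append hP.rv⟩) hp hp ?_ (by simp) (by simp; omega)
      simp only [List.mem_append, List.mem_cons]
      rintro o (ho | rfl | ho | ho)
      exacts [hP1F o ho, hKF _ hk, hK2F o ho, hFrv hPF o ho]
    · refine short (L := P₀ ++ [f] ++ (K₁ ++ S.rv P₁)) (q := opp p)
        (hP.append (h1.append (h ▸ hP'.1.rv))) hp hp ?_ (by simp) (by simp; omega)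
      intro o ho
      rcases List.mem_append.1 ho with ho | ho
      · exact hPF o ho
      · rcases List.mem_append.1 ho with ho | ho
        exacts [hK1F o ho, hFrv hP1F o ho]
  refine ⟨f, {v | ∃ k ∈ K, S.src k = v}, P₀, p, S.arr f, ⟨hPF f (by simp), hPX f (by simp), hfX,
    ?_⟩, ?_, ?_, hP, hp, (List.pairwise_append.1 hpw).1, fun o ho => ⟨hPF o ho, hPX o ho⟩⟩
  · rintro v ⟨k, hk, rfl⟩ s
    obtain ⟨K₁, K₂, e, h1, h2⟩ := split k hk
    rw [e] at hKpw
    -- The loop leads from `S.arr f` to its opposite state, so it can be run from either end: one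
    -- direction reaches each of the two states at a vertex.
    rcases eq_or_eq_opp (p := (S.src k, s)) (q := S.dep k) rfl with h | h
    · rw [h]
      refine ⟨K₁, h1, (List.pairwise_append.1 hKpw).1, fun o ho => ?_⟩
      have : o ∈ K := by simp [e, ho]
      exact ⟨hKF o this, hKX o this⟩
    · rw [h]
      have h3 : S.Path (S.dep k) (k :: K₂) (opp (S.arr f)) := ⟨rfl, h2⟩
      refine ⟨S.rv (k :: K₂), by simpa using h3.rv,
        pairwise_rv (List.pairwise_append.1 hKpw).2.1, fun o ho => ?_⟩
      have : S.rev o ∈ K := by rw [e]; exact List.mem_append_right _ (mem_rv.1 ho)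
      exact ⟨by simpa [S.rev_rev] using hF _ (hKF _ this), inner_rev.1 (hKX _ this)⟩
  · rintro ⟨k, hk, hkr⟩
    obtain ⟨K₁, K₂, e, h1, h2⟩ := split k hk
    have l1 := congrArg List.length e
    simp only [List.length_append, List.length_cons] at l1
    refine short (hP.append h1) hp hkr (fun o ho => ?_) (by simp) (by simp; omega)
    rw [List.mem_append] at ho
    rcases ho with ho | ho
    exacts [hPF o ho, hKF o (by simp [e, ho])]
  · obtain ⟨k, hk, -⟩ := hfX
    exact ⟨k, hKF k hk, hKX k hk⟩

/-! ### Contracting a blossom -/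

open Classical in
variable (S) in
/-- The system obtained by contracting `X` to the head of `f`: there, the dart `f` arrives
with sign `1` and all other darts arrive with sign `-1`. -/
noncomputable def contract (f : O) (X : Set V) : DartSystem O V where
  rev := S.rev
  rev_rev := S.rev_rev
  src o := if S.src o ∈ X then S.tgt f else S.src o
  sgn o := if S.src o ∈ X then (if o = S.rev f then 1 else -1) else S.sgn o

section contract

variable {f : O} {X : Set V}

lemma contract_src_of_notMem {o : O} (h : S.src o ∉ X) : (S.contract f X).src o = S.src o :=
  if_neg h

lemma contract_dep_of_notMem {o : O} (h : S.src o ∉ X) : (S.contract f X).dep o = S.dep o := by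
  simp [dep, contract, h]

lemma contract_arr_of_notMem {o : O} (h : S.tgt o ∉ X) : (S.contract f X).arr o = S.arr o := by
  have h' : S.src (S.rev o) ∉ X := h
  simp only [arr, tgt, contract]
  rw [if_neg h', if_neg h']

lemma contract_tgt_of_notMem {o : O} (h : S.tgt o ∉ X) : (S.contract f X).tgt o = S.tgt o :=
  if_neg h

lemma contract_src_of_mem {o : O} (h : S.src o ∈ X) : (S.contract f X).src o = S.tgt f :=
  if_pos h

lemma contract_tgt_of_mem {o : O} (h : S.tgt o ∈ X) : (S.contract f X).tgt o = S.tgt f :=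
  if_pos h

lemma contract_dep_of_mem {o : O} (h : S.src o ∈ X) (ho : o ≠ S.rev f) :
    (S.contract f X).dep o = (S.tgt f, 1) := by
  simp [dep, contract, h, ho]

lemma contract_arr_of_mem {o : O} (h : S.tgt o ∈ X) (ho : o ≠ f) :
    (S.contract f X).arr o = (S.tgt f, -1) := by
  have h' : S.src (S.rev o) ∈ X := h
  have ho' : S.rev o ≠ S.rev f := fun e => ho (by rw [← S.rev_rev o, e, S.rev_rev])
  simp only [arr, tgt, contract]
  rw [if_pos h', if_pos h', if_neg ho']

lemma contract_arr_self (h : S.tgt f ∈ X) : (S.contract f X).arr f = (S.tgt f, 1) := by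
  have h' : S.src (S.rev f) ∈ X := h
  simp only [arr, tgt, contract]
  rw [if_pos h', if_pos h', if_true]

lemma contract_dep_rev_self (h : S.tgt f ∈ X) :
    (S.contract f X).dep (S.rev f) = (S.tgt f, -1) := by
  have := dep_rev (S := S.contract f X) f
  rw [contract_arr_self h] at this
  exact this

lemma mem_of_contract_src {o : O} (h : (S.contract f X).src o ∈ X) :
    S.src o ∈ X := by
  by_contra hc
  rw [contract_src_of_notMem hc] at h
  exact hc h

lemma mem_of_contract_tgt {o : O} (h : (S.contract f X).tgt o ∈ X) :
    S.tgt o ∈ X := mem_of_contract_src (o := S.rev o) h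

lemma contract_src_mem_iff (hf : S.tgt f ∈ X) {o : O} :
    (S.contract f X).src o ∈ X ↔ S.src o ∈ X :=
  ⟨mem_of_contract_src, fun h => by rwa [contract_src_of_mem h]⟩

/-- At the contracted vertex all darts other than `f` and its reverse have the same sign, so a path
avoiding these two cannot pass through it. Away from `X` the two systems agree. -/
lemma Path.of_contract_of_notMem (hf : S.tgt f ∈ X) {p q : V × ℤˣ} {L : List O}
    (h : (S.contract f X).Path p L q) (hp : p.1 ∉ X) (hq : q.1 ∉ X) (h1 : f ∉ L)
    (h2 : S.rev f ∉ L) : S.Path p L q := by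
  induction L generalizing p with
  | nil => exact h
  | cons o L ih =>
    obtain ⟨rfl, h⟩ := h
    have hs : S.src o ∉ X := fun hc => hp ((contract_src_mem_iff hf).2 hc)
    refine ⟨(contract_dep_of_notMem hs).symm, ?_⟩
    have hL1 : f ∉ L := fun hc => h1 (List.mem_cons_of_mem _ hc)
    have hL2 : S.rev f ∉ L := fun hc => h2 (List.mem_cons_of_mem _ hc)
    by_cases ht : S.tgt o ∈ X
    · rw [contract_arr_of_mem ht (fun e => h1 (by simp [e]))] at h
      cases L with
      | nil => rw [← path_nil.1 h] at hq; exact absurd hf hq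
      | cons b L =>
        exfalso
        have hb : b ≠ S.rev f := fun e => hL2 (by simp [e])
        have hbX : S.src b ∈ X := by
          apply mem_of_contract_src (f := f)
          rw [← dep_fst, h.1]
          exact hf
        have := h.1
        rw [contract_dep_of_mem hbX hb] at this
        have h11 : (1 : ℤˣ) = -1 := congrArg Prod.snd this
        exact absurd h11 (by decide)
    · rw [contract_arr_of_notMem ht] at h
      exact ih h ht hL1 hL2

/-- Only the last dart can end in `X`, so contraction changes at most the final state, whence the
new `q'`. -/
lemma Path.contract {p q : V × ℤˣ} {L : List O} (h : S.Path p L q) (hL : ∀ o ∈ L, S.src o ∉ X) :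
    ∃ q', (S.contract f X).Path p L q' := by
  induction L generalizing p with
  | nil => exact ⟨p, rfl⟩
  | cons o L ih =>
    obtain ⟨rfl, h⟩ := h
    cases L with
    | nil => exact ⟨_, contract_dep_of_notMem (hL o (by simp)), rfl⟩
    | cons b L =>
      obtain ⟨q', hq'⟩ := ih h fun o ho => hL o (by simp [ho])
      refine ⟨q', contract_dep_of_notMem (hL o (by simp)), ?_⟩
      have hb : S.src b = S.tgt o := congrArg Prod.fst h.1
      rwa [contract_arr_of_notMem (hb ▸ hL b (by simp))]

variable (S) in
/-- The darts of `F` without the inner darts of `X`. -/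
def outer (F : Set O) (X : Set V) : Set O := {o ∈ F | ¬ S.Inner X o}

/-- A trail of the contracted system lifts to a trail that, in addition, uses only
inner darts of the blossom. -/
lemma IsBlossom.lift_aux {F : Set O} (hb : S.IsBlossom F f X) {p q : V × ℤˣ} {L : List O}
    (h : (S.contract f X).Path p L q) (hp : p.1 ∉ X) (hq : q.1 ∉ X)
    (hL : ∀ o ∈ L, o ∈ S.outer F X) (hpw : L.Pairwise S.Apart) (hfL : f ∈ L) :
    ∃ M, S.Path p M q ∧ M.Pairwise S.Apart ∧ (∀ o ∈ M, o ∈ F) ∧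
      ∃ L₁ Z L₂, L = L₁ ++ L₂ ∧ M = L₁ ++ Z ++ L₂ ∧ ∀ o ∈ Z, S.Inner X o := by
  obtain ⟨L₁, L₂, rfl⟩ := List.append_of_mem hfL
  rw [path_append_cons, contract_dep_of_notMem hb.src_notMem, contract_arr_self hb.tgt_mem] at h
  have hpw' := hpw
  rw [List.pairwise_append, List.pairwise_cons] at hpw
  obtain ⟨hpw1, ⟨hf2, hpw2⟩, hpw12⟩ := hpw
  have h1 : S.Path p L₁ (S.dep f) := h.1.of_contract_of_notMem hb.tgt_mem hp hb.src_notMem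
    (fun hc => (hpw12 f hc f (by simp)).1 rfl) (fun hc => (hpw12 _ hc f (by simp)).2 rfl)
  obtain ⟨-, h⟩ := h
  cases L₂ with
  | nil => rw [← path_nil.1 h] at hq; exact absurd hb.tgt_mem hq
  | cons b L₃ =>
    have hbX : S.src b ∈ X := by
      apply mem_of_contract_src (f := f)
      rw [← dep_fst, h.1]
      exact hb.tgt_mem
    have hbo := hL b (by simp)
    have hbt : S.tgt b ∉ X := fun hc => hbo.2 ⟨hbX, hc⟩
    have h2 := h.2
    rw [contract_arr_of_notMem hbt] at h2
    have h3 : S.Path (S.arr b) L₃ q := h2.of_contract_of_notMem hb.tgt_mem hbt hq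
      (fun hc => (hf2 f (List.mem_cons_of_mem _ hc)).1 rfl)
      (fun hc => (hf2 _ (List.mem_cons_of_mem _ hc)).2 (S.rev_rev f).symm)
    -- The blossom bridges the gap hidden by the contraction, from the arrival of `f` to the
    -- departure of `b`.
    obtain ⟨Z, hZ, hZpw, hZX⟩ := hb.reach (S.src b) hbX (-S.sgn b)
    have hZa : ∀ z ∈ Z, ∀ o ∈ L₁ ++ f :: b :: L₃, S.Apart z o := fun z hz o ho =>
      (hZX z hz).2.apart (hL o ho).2
    refine ⟨(L₁ ++ [f]) ++ Z ++ b :: L₃, ?_, ?_, ?_, L₁ ++ [f], Z, b :: L₃, by simp, rfl,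
      fun o ho => (hZX o ho).2⟩
    · refine (Path.append (m := S.dep b) ?_ ⟨rfl, h3⟩)
      exact Path.append (m := S.arr f) (h1.append ⟨rfl, rfl⟩) hZ
    · have e : (L₁ ++ [f]) ++ b :: L₃ = L₁ ++ f :: b :: L₃ := by simp
      rw [← e] at hpw' hZa
      rw [List.pairwise_append] at hpw' ⊢
      refine ⟨?_, hpw'.2.1, fun a ha c hc => ?_⟩
      · rw [List.pairwise_append]
        exact ⟨hpw'.1, hZpw, fun a ha c hc => (hZa c hc a (List.mem_append_left _ ha)).symm⟩
      · rcases List.mem_append.1 ha with ha | ha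
        · exact hpw'.2.2 a ha c hc
        · exact hZa a ha c (List.mem_append_right _ hc)
    · intro o ho
      simp only [List.append_assoc, List.mem_append] at ho
      rcases ho with ho | ho | ho | ho
      · exact (hL o (by simp [ho])).1
      · exact (hL o (by simp at ho; simp [ho])).1
      · exact (hZX o ho).1
      · exact (hL o (by simp at ho; simp [ho])).1

/-- A path using `f` backwards is reversed first; one using neither direction of `f` avoids `X` and
needs no change. -/
lemma IsBlossom.lift {F : Set O} (hF : ∀ o ∈ F, S.rev o ∈ F) (hb : S.IsBlossom F f X)
    {p q : V × ℤˣ} {L : List O} (h : (S.contract f X).Path p L q) (hp : p.1 ∉ X) (hq : q.1 ∉ X)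
    (hL : ∀ o ∈ L, o ∈ S.outer F X) (hpw : L.Pairwise S.Apart) :
    ∃ M, S.Path p M q ∧ M.Pairwise S.Apart ∧ (∀ o ∈ M, o ∈ F) ∧
      ∃ L₁ Z L₂, L = L₁ ++ L₂ ∧ M = L₁ ++ Z ++ L₂ ∧ ∀ o ∈ Z, S.Inner X o := by
  by_cases h1 : f ∈ L
  · exact hb.lift_aux h hp hq hL hpw h1
  by_cases h2 : S.rev f ∈ L
  · obtain ⟨M, hM, hMpw, hMF, L₁, Z, L₂, e1, e2, hZ⟩ := hb.lift_aux (L := S.rv L) h.rv hq hp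
      (fun o ho => by
        have := hL _ (mem_rv.1 ho)
        exact ⟨by simpa [S.rev_rev] using hF _ this.1, fun hc => this.2 hc.rev⟩)
      (pairwise_rv hpw) (mem_rv.2 h2)
    refine ⟨S.rv M, by simpa using hM.rv, pairwise_rv hMpw, fun o ho => ?_, S.rv L₂, S.rv Z,
      S.rv L₁, ?_, ?_, fun o ho => inner_rev.1 (hZ _ (mem_rv.1 ho))⟩
    · simpa [S.rev_rev] using hF _ (hMF _ (mem_rv.1 ho))
    · rw [← rv_append, ← e1, rv_rv]
    · simp [e2]
  · exact ⟨L, h.of_contract_of_notMem hb.tgt_mem hp hq h1 h2, hpw, fun o ho => (hL o ho).1, L, [],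
      [], by simp, by simp, by simp⟩

end contract

/-! ### Barriers -/

variable (S) in
/-- A barrier: the vertices are divided into classes with labels `c v`, some of which are marked as
blobs. Trails from `r` change their class only along the arcs in `A`. A class that is no blob is
a single vertex. A blob `y` is entered only by `ent y`, from which every state at a vertex of the
blob is reached by a trail inside the blob. -/
structure IsBarrier (F : Set O) (r : V) (c : V → V) (blob : Set V) (A : Set O) (ent : V → O) :
    Prop where
  root_notMem : c r ∉ blob
  inj : ∀ u v, c u = c v → c u ∉ blob → u = v
  subset : A ⊆ F
  of_root : ∀ o ∈ F, S.src o = r → o ∈ A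
  rev_notMem : ∀ o ∈ A, S.rev o ∉ A
  tgt_ne : ∀ o ∈ A, S.tgt o ≠ r
  eq_ent : ∀ a ∈ A, c (S.tgt a) ∈ blob → a = ent (c (S.tgt a))
  of_dep : ∀ a ∈ A, c (S.tgt a) ∉ blob → ∀ o ∈ F, S.dep o = S.arr a → o ∈ A
  arr_eq : ∀ a ∈ A, ∀ b ∈ A, S.tgt a = S.src b → c (S.tgt a) ∉ blob → S.arr a = S.dep b
  of_blob : ∀ o ∈ F, c (S.src o) ∈ blob → c (S.tgt o) ≠ c (S.src o) →
    o ≠ S.rev (ent (c (S.src o))) → o ∈ A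
  ne_of_blob : ∀ a ∈ A, c (S.src a) ∈ blob → c (S.tgt a) ≠ c (S.src a)
  ent_mem : ∀ y ∈ blob, ent y ∈ A
  ent_tgt : ∀ y ∈ blob, c (S.tgt (ent y)) = y
  reach : ∀ v, c v ∈ blob → ∀ s, ∃ Z : List O, S.Path (S.arr (ent (c v))) Z (v, s) ∧
    Z.Pairwise S.Apart ∧ ∀ o ∈ Z, o ∈ F ∧ S.Inner {u | c u = c v} o

/-- A trail inside a blob has already spent its entering arc, so it cannot leave backwards through
it, and all other exits are arcs. At a single vertex, every continuation from a state in which an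
arc arrives is again an arc. -/
lemma IsBarrier.of_trail {F : Set O} {r : V} {c : V → V} {blob : Set V} {A : Set O} {ent : V → O}
    (hB : S.IsBarrier F r c blob A ent) {p q : V × ℤˣ} {L : List O} (h : S.Path p L q)
    (hL : ∀ o ∈ L, o ∈ F) (hpw : L.Pairwise S.Apart) (hp : p.1 = r) :
    ∀ o ∈ L, o ∈ A ∨ (c (S.src o) ∈ blob ∧ c (S.tgt o) = c (S.src o)) := by
  replace hp : p.1 = r ∨ (c p.1 ∉ blob ∧ ∃ a ∈ A, p = S.arr a) ∨
    (c p.1 ∈ blob ∧ ∀ o ∈ L, o ≠ S.rev (ent (c p.1))) := Or.inl hp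
  induction L generalizing p with
  | nil => simp
  | cons o L ih =>
    obtain ⟨rfl, h⟩ := h
    rw [List.pairwise_cons] at hpw
    have hoF := hL o (by simp)
    have key : o ∈ A ∨ (c (S.src o) ∈ blob ∧ c (S.tgt o) = c (S.src o)) := by
      rcases hp with hp | ⟨hp, a, ha, e⟩ | ⟨hp, hp'⟩
      · exact Or.inl (hB.of_root o hoF hp)
      · refine Or.inl (hB.of_dep a ha ?_ o hoF e)
        have := congrArg Prod.fst e
        simp only [dep_fst, arr_fst] at this
        rwa [← this]
      · by_cases hc : c (S.tgt o) = c (S.src o)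
        · exact Or.inr ⟨hp, hc⟩
        · exact Or.inl (hB.of_blob o hoF hp hc (hp' o (by simp)))
    have hnext : (S.arr o).1 = r ∨ (c (S.arr o).1 ∉ blob ∧ ∃ a ∈ A, S.arr o = S.arr a) ∨
        (c (S.arr o).1 ∈ blob ∧ ∀ o' ∈ L, o' ≠ S.rev (ent (c (S.arr o).1))) := by
      rcases key with hA | ⟨hs, ht⟩
      · by_cases hb : c (S.tgt o) ∈ blob
        · refine Or.inr (Or.inr ⟨hb, fun o' ho' e => ?_⟩)
          simp only [arr_fst] at e
          rw [← hB.eq_ent o hA hb] at e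
          exact (hpw.1 o' ho').2 (by rw [e, S.rev_rev])
        · exact Or.inr (Or.inl ⟨hb, o, hA, rfl⟩)
      · refine Or.inr (Or.inr ⟨by simpa [ht] using hs, fun o' ho' => ?_⟩)
        simp only [arr_fst, ht]
        rcases hp with hp | ⟨hp, -⟩ | ⟨-, hp⟩
        · simp only [dep_fst] at hp
          exact absurd (hp ▸ hs) hB.root_notMem
        · exact absurd hs hp
        · exact hp o' (by simp [ho'])
    intro o' ho'
    rcases List.mem_cons.1 ho' with rfl | ho'
    · exact key
    · exact ih h (fun o ho => hL o (by simp [ho])) hpw.2 hnext o' ho'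

/-- Without closed walks at the root there is a barrier without blobs. -/
lemma exists_barrier_of_no_closedWalk {F : Set O} (hF : ∀ o ∈ F, S.rev o ∈ F) {r : V}
    (hr : ∀ L, ¬ S.IsClosedWalk F r L) [Nonempty O] :
    ∃ c blob A ent, S.IsBarrier F r c blob A ent := by
  -- The darts traversed by walks from `r`, repetitions allowed: if both directions of an edge
  -- occurred, two such walks would combine to a closed walk.
  let A : Set O := {o | ∃ L p, S.Path p (L ++ [o]) (S.arr o) ∧ p.1 = r ∧ ∀ o' ∈ L ++ [o], o' ∈ F}
  have hclosed : ∀ o ∈ A, S.rev o ∉ A := by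
    rintro o ⟨L, p, hL, hp, hLF⟩ ⟨M, q, hM, hq, hMF⟩
    refine hr (L ++ o :: S.rv M) ⟨by simp, fun o' ho' => ?_, p, opp q, ?_, hp, hq⟩
    · rcases List.mem_append.1 ho' with h | h
      · exact hLF _ (by simp [h])
      rcases List.mem_cons.1 h with rfl | h
      · exact hLF _ (by simp)
      · simpa [S.rev_rev] using hF _ (hMF _ (List.mem_append_left _ (mem_rv.1 h)))
    · rw [path_append_cons] at hL hM ⊢
      refine ⟨hL.1, ?_⟩
      simpa using hM.1.rv
  have hext : ∀ a ∈ A, ∀ o ∈ F, S.dep o = S.arr a → o ∈ A := by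
    rintro a ⟨L, p, hL, hp, hLF⟩ o ho e
    refine ⟨L ++ [a], p, hL.append ⟨e, rfl⟩, hp, fun o' ho' => ?_⟩
    rcases List.mem_append.1 ho' with h | h
    · exact hLF _ h
    · rw [List.mem_singleton.1 h]; exact ho
  have hAF : A ⊆ F := fun o ⟨L, p, _, _, h⟩ => h o (by simp)
  have htgt : ∀ o ∈ A, S.tgt o ≠ r := by
    rintro o ⟨L, p, hL, hp, hLF⟩ e
    exact hr (L ++ [o]) ⟨by simp, hLF, _, _, hL, hp, e⟩
  refine ⟨id, ∅, A, fun _ => Classical.arbitrary O, ?_⟩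
  constructor
  case of_root => exact fun o ho e => ⟨[], S.dep o, ⟨rfl, rfl⟩, e, by simpa using ho⟩
  case arr_eq =>
    intro a ha b hb e _
    rcases eq_or_eq_opp (p := S.arr a) (q := S.dep b) e with h | h
    · exact h
    -- If the states were opposite, a walk ending with `a` could go on backwards along the
    -- predecessor `b'` of `b`, putting both directions of `b'` in `A`. Without a predecessor, `a`
    -- would end at the root.
    obtain ⟨L, p, hL, hp, hLF⟩ := hb
    rcases List.eq_nil_or_concat' L with rfl | ⟨L, b', rfl⟩
    · exfalso
      obtain ⟨h1, -⟩ := hL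
      rw [← h1] at hp
      exact htgt a ha (e.trans hp)
    · exfalso
      rw [path_append_cons] at hL
      have h2 : S.arr b' = S.dep b := (path_append_cons.1 hL.1).2
      have hb' : b' ∈ A := ⟨L, p, by rw [h2]; exact hL.1, hp, fun o ho => hLF o
        (List.mem_append_left _ ho)⟩
      refine hclosed b' hb' (hext a ha _ (hF _ (hAF hb')) ?_)
      rw [dep_rev, h2, h]
  all_goals first | assumption | simp
  · exact fun a ha o => hext a ha o

lemma IsBarrier.src_ent_ne {F : Set O} {r : V} {c : V → V} {blob : Set V} {A : Set O} {ent : V → O}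
    (hB : S.IsBarrier F r c blob A ent) {y : V} (hy : y ∈ blob) : c (S.src (ent y)) ≠ y := fun h =>
  hB.ne_of_blob _ (hB.ent_mem y hy) (by rwa [h]) (by rw [hB.ent_tgt y hy, h])

/-- The trails required inside a blob of a contracted barrier lift to the original system. -/
lemma IsBarrier.reach_of_contract {F : Set O} (hF : ∀ o ∈ F, S.rev o ∈ F) {r : V} {f : O}
    {X : Set V} (hb : S.IsBlossom F f X) {c : V → V} {blob : Set V} {A : Set O} {ent : V → O}
    (hB : (S.contract f X).IsBarrier (S.outer F X) r c blob A ent) {k : V → V}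
    (hkX : ∀ v ∈ X, k v = c (S.tgt f)) (hk : ∀ v, v ∉ X → k v = c v) {v : V} (hv : k v ∈ blob)
    (s : ℤˣ) : ∃ Z : List O, S.Path (S.arr (ent (k v))) Z (v, s) ∧
    Z.Pairwise S.Apart ∧ ∀ o ∈ Z, o ∈ F ∧ S.Inner {u | k u = k v} o := by
  set y := k v with hy
  set e := ent y with he
  have hsrc : ∀ o, c ((S.contract f X).src o) = k (S.src o) := fun o => by
    by_cases h : S.src o ∈ X
    · rw [contract_src_of_mem h, hkX _ h]
    · rw [contract_src_of_notMem h, hk _ h]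
  have htgt : ∀ o, c ((S.contract f X).tgt o) = k (S.tgt o) := fun o => hsrc (S.rev o)
  have hinner : ∀ {o}, (S.contract f X).Inner {u | c u = y} o → S.Inner {u | k u = y} o :=
    fun {o} h => ⟨(hsrc o).symm.trans h.1, (htgt o).symm.trans h.2⟩
  have he' : ¬ S.Inner {u | k u = y} e := fun h => hB.src_ent_ne hv ((hsrc _).trans h.1)
  have hcons : ∀ {Z : List O}, Z.Pairwise S.Apart → (∀ o ∈ Z, S.Inner {u | k u = y} o) →
      (e :: Z).Pairwise S.Apart := fun h1 h2 =>
    List.pairwise_cons.2 ⟨fun o ho => ((h2 o ho).apart he').symm, h1⟩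
  have heF : e ∈ S.outer F X := hB.subset (hB.ent_mem y hv)
  have hXy : c (S.tgt f) = y → ∀ o, S.Inner X o → S.Inner {u | k u = y} o :=
    fun h o ho => ⟨(hkX _ ho.1).trans h, (hkX _ ho.2).trans h⟩
  have heX : c (S.tgt f) = y → S.src e ∉ X := fun h hc =>
    hB.src_ent_ne hv (by rw [← he, hsrc, hkX _ hc, h])
  by_cases hvX : v ∈ X
  · have hcy : c (S.tgt f) = y := (hkX v hvX).symm
    -- Only `f` arrives at the contracted vertex with sign `1`. So this trail, preceded by the
    -- entrance `e`, ends with `f`, and the blossom continues it to `(v, s)`.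
    obtain ⟨Z, hZ, hZpw, hZi⟩ := hB.reach (S.tgt f) (by rwa [hcy]) 1
    rw [hcy] at hZ hZi
    have hpw := hcons hZpw fun o ho => hinner (hZi o ho).2
    have hpath : (S.contract f X).Path ((S.contract f X).dep e) (e :: Z) (S.tgt f, 1) := ⟨rfl, hZ⟩
    rcases List.eq_nil_or_concat' (e :: Z) with h | ⟨L, l, hl⟩
    · simp at h
    rw [hl] at hpath hpw
    rw [path_append_cons] at hpath
    have hlf : l = f := by
      by_contra hlf
      have h1 : (S.contract f X).arr l = (S.tgt f, 1) := hpath.2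
      have h2 : S.tgt l ∈ X := mem_of_contract_tgt (f := f) (by
        rw [← arr_fst, h1]; exact hb.tgt_mem)
      rw [contract_arr_of_mem h2 hlf] at h1
      have h11 : (-1 : ℤˣ) = 1 := congrArg Prod.snd h1
      exact absurd h11 (by decide)
    subst hlf
    have hLa := (List.pairwise_append.1 hpw).2.2
    have hL : S.Path (S.dep e) L (S.dep l) := by
      have := hpath.1
      rw [contract_dep_of_notMem hb.src_notMem, contract_dep_of_notMem (heX hcy)] at this
      exact this.of_contract_of_notMem hb.tgt_mem (heX hcy) hb.src_notMem
        (fun hc => (hLa l hc l (by simp)).1 rfl) (fun hc => (hLa _ hc l (by simp)).2 rfl)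
    obtain ⟨Y, hY, hYpw, hYX⟩ := hb.reach v hvX s
    cases L with
    | nil =>
      simp only [List.nil_append, List.cons.injEq] at hl
      rw [hl.1]
      exact ⟨Y, hY, hYpw, fun o ho => ⟨(hYX o ho).1, hXy hcy o (hYX o ho).2⟩⟩
    | cons a L =>
      simp only [List.cons_append, List.cons.injEq] at hl
      obtain ⟨rfl, rfl⟩ := hl
      refine ⟨L ++ [l] ++ Y, ?_, ?_, ?_⟩
      · exact Path.append (path_append_cons.2 ⟨hL.2, rfl⟩) hY
      · rw [List.pairwise_append]
        exact ⟨hZpw, hYpw, fun a ha b hb => ((hYX b hb).2.apart (hZi a ha).1.2).symm⟩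
      · intro o ho
        rcases List.mem_append.1 ho with h | h
        · exact ⟨(hZi o h).1.1, hinner (hZi o h).2⟩
        · exact ⟨(hYX o h).1, hXy hcy o (hYX o h).2⟩
  · have hcv : y = c v := hk v hvX
    obtain ⟨Z, hZ, hZpw, hZi⟩ := hB.reach v (by rwa [← hcv]) s
    rw [← hcv] at hZ hZi
    by_cases hcy : c (S.tgt f) = y
    -- The entrance `e` is prepended since lifting needs a start outside `X`. The inserted piece
    -- cannot precede `e`, which is therefore removable afterwards.
    · have hpath : (S.contract f X).Path (S.dep e) (e :: Z) (v, s) :=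
        ⟨contract_dep_of_notMem (heX hcy), hZ⟩
      obtain ⟨M, hM, hMpw, hMF, L₁, Y, L₂, e1, rfl, hY⟩ := hb.lift hF hpath (heX hcy) hvX
        (by
          intro o ho
          rcases List.mem_cons.1 ho with rfl | ho
          exacts [heF, (hZi o ho).1])
        (hcons hZpw fun o ho => hinner (hZi o ho).2)
      obtain ⟨N, hN, hNm⟩ : ∃ N, L₁ ++ Y ++ L₂ = e :: N ∧ ∀ o ∈ N, o ∈ Z ∨ S.Inner X o := by
        cases L₁ with
        | nil =>
          cases Y with
          | nil => exact ⟨Z, by simpa using e1.symm, fun o ho => Or.inl ho⟩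
          | cons z Y =>
            have h1 : S.src z = S.src e := congrArg Prod.fst hM.1
            exact absurd (h1 ▸ (hY z (by simp)).1) (heX hcy)
        | cons a L₁ =>
          simp only [List.cons_append, List.cons.injEq] at e1
          obtain ⟨rfl, rfl⟩ := e1
          refine ⟨L₁ ++ Y ++ L₂, by simp [he], fun o ho => ?_⟩
          simp only [List.mem_append] at ho ⊢
          rcases ho with (ho | ho) | ho
          exacts [Or.inl (Or.inl ho), Or.inr (hY o ho), Or.inl (Or.inr ho)]
      rw [hN] at hM hMpw hMF
      refine ⟨N, hM.2, (List.pairwise_cons.1 hMpw).2, fun o ho => ⟨hMF o (by simp [ho]), ?_⟩⟩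
      rcases hNm o ho with h | h
      · exact hinner (hZi o h).2
      · exact hXy hcy o h
    · have hnX : ∀ u, k u = y → u ∉ X := fun u hu hc => hcy (by rw [← hkX u hc, hu])
      have hte : S.tgt e ∉ X := hnX _ (by rw [← htgt]; exact hB.ent_tgt y hv)
      have hZi' : ∀ o ∈ Z, S.Inner {u | k u = y} o := fun o ho => hinner (hZi o ho).2
      rw [← he, contract_arr_of_notMem hte] at hZ
      exact ⟨Z, hZ.of_contract_of_notMem hb.tgt_mem hte hvX
        (fun hc => hnX _ (hZi' f hc).2 hb.tgt_mem) (fun hc => hnX _ (hZi' _ hc).1 hb.tgt_mem),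
        hZpw, fun o ho => ⟨(hZi o ho).1.1, hZi' o ho⟩⟩

/-- A barrier of the contracted system yields one of the original system. -/
lemma IsBarrier.of_contract {F : Set O} (hF : ∀ o ∈ F, S.rev o ∈ F) {r : V} {f : O}
    {X : Set V} (hb : S.IsBlossom F f X) (hrX : r ∉ X) {c : V → V} {blob : Set V} {A : Set O}
    {ent : V → O} (hB : (S.contract f X).IsBarrier (S.outer F X) r c blob A ent)
    (hf : f ∈ A ∨ c (S.tgt f) ∈ blob) : ∃ c blob ent, S.IsBarrier F r c blob A ent := by
  classical
  -- All of `X` inherits the class of the contracted vertex, represented by `S.tgt f`.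
  obtain ⟨k, hkX, hk⟩ : ∃ k : V → V, (∀ v ∈ X, k v = c (S.tgt f)) ∧ ∀ v, v ∉ X → k v = c v :=
    ⟨fun v => if v ∈ X then c (S.tgt f) else c v, fun v h => if_pos h, fun v h => if_neg h⟩
  have hsrc : ∀ o, c ((S.contract f X).src o) = k (S.src o) := fun o => by
    by_cases h : S.src o ∈ X
    · rw [contract_src_of_mem h, hkX _ h]
    · rw [contract_src_of_notMem h, hk _ h]
  have htgt : ∀ o, c ((S.contract f X).tgt o) = k (S.tgt o) := fun o => hsrc (S.rev o)
  -- If the class of the contracted vertex is not yet a blob, it becomes one with entrance `f`.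
  obtain ⟨ent', he1, he2⟩ : ∃ ent' : V → O, (∀ y ∈ blob, ent' y = ent y) ∧
      (c (S.tgt f) ∉ blob → ent' (c (S.tgt f)) = f) :=
    ⟨fun y => if y ∈ blob then ent y else f, fun y h => if_pos h, fun h => if_neg h⟩
  have hXc : c (S.tgt f) ∉ blob → ∀ v, k v = c (S.tgt f) → v ∈ X := fun h v hv => by
    by_contra hc
    rw [hk v hc] at hv
    exact hc (hB.inj v _ hv (by rwa [hv]) ▸ hb.tgt_mem)
  have hkB : ∀ y ∈ insert (c (S.tgt f)) blob, y ∈ blob ∨ (y = c (S.tgt f) ∧ c (S.tgt f) ∉ blob) :=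
    fun y hy => by
      by_cases h : c (S.tgt f) ∈ blob
      · exact Or.inl (by simpa [h] using hy)
      · rcases hy with hy | hy
        exacts [Or.inr ⟨hy, h⟩, Or.inl hy]
  have hnX : ∀ v, k v ∉ insert (c (S.tgt f)) blob → v ∉ X := fun v hv hc =>
    hv (by rw [hkX v hc]; exact Set.mem_insert _ _)
  have hnb : ∀ v, k v ∉ insert (c (S.tgt f)) blob → c v ∉ blob := fun v hv hc =>
    hv (by rw [hk v (hnX v hv)]; exact Set.mem_insert_of_mem _ hc)
  refine ⟨k, insert (c (S.tgt f)) blob, ent', ?_⟩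
  constructor
  case root_notMem =>
    intro h
    rw [hk r hrX] at h
    rcases hkB _ h with h | ⟨h, h'⟩
    · exact hB.root_notMem h
    · exact hrX (hXc h' r (by rw [hk r hrX, h]))
  case inj =>
    intro u v huv hu
    have hu' := hnX u hu
    have hv' := hnX v (huv ▸ hu)
    refine hB.inj u v ?_ (hnb u hu)
    rwa [hk u hu', hk v hv'] at huv
  case subset => exact fun o ho => (hB.subset ho).1
  case of_root =>
    intro o ho h
    have h' : S.src o ∉ X := h ▸ hrX
    exact hB.of_root o ⟨ho, fun hc => h' hc.1⟩ (by rw [contract_src_of_notMem h', h])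
  case rev_notMem => exact hB.rev_notMem
  case tgt_ne =>
    intro o ho h
    exact hB.tgt_ne o ho (by rw [contract_tgt_of_notMem (h ▸ hrX), h])
  case eq_ent =>
    intro a ha h
    rcases hkB _ h with h | ⟨h, h'⟩
    · rw [he1 _ h]
      have := hB.eq_ent a ha
      rw [htgt] at this
      exact this h
    · rw [h, he2 h']
      have hfA : f ∈ A := hf.resolve_right h'
      -- Another arc into `X` would arrive in the state from which the reverse of `f` departs, so
      -- both directions of `f` would be arcs.
      by_contra hc
      have haX := hXc h' _ h
      refine hB.rev_notMem f hfA (hB.of_dep a ha ?_ (S.rev f)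
        ⟨hF _ hb.mem, fun hi => hb.src_notMem (by simpa using hi.2)⟩ ?_)
      · rwa [htgt, h]
      · rw [contract_dep_rev_self hb.tgt_mem, contract_arr_of_mem haX hc]
  case of_dep =>
    intro a ha h o ho e
    have haX := hnX _ h
    have e' : S.src o = S.tgt a := congrArg Prod.fst e
    have hoX : S.src o ∉ X := e' ▸ haX
    refine hB.of_dep a ha ?_ o ⟨ho, fun hc => hoX hc.1⟩ ?_
    · rw [contract_tgt_of_notMem haX]; exact hnb _ h
    · rw [contract_dep_of_notMem hoX, contract_arr_of_notMem haX, e]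
  case arr_eq =>
    intro a ha b hb' e h
    have haX := hnX _ h
    have hbX : S.src b ∉ X := e ▸ haX
    have := hB.arr_eq a ha b hb'
    rw [contract_tgt_of_notMem haX, contract_src_of_notMem hbX, contract_arr_of_notMem haX,
      contract_dep_of_notMem hbX] at this
    exact this e (hnb _ h)
  case of_blob =>
    intro o ho h h1 h2
    have hoo : o ∈ S.outer F X := ⟨ho, fun hc => h1 (by rw [hkX _ hc.1, hkX _ hc.2])⟩
    rcases hkB _ h with h | ⟨h, h'⟩
    · rw [he1 _ h] at h2
      have := hB.of_blob o hoo
      rw [hsrc, htgt] at this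
      exact this h h1 h2
    · rw [h, he2 h'] at h2
      refine hB.of_dep f (hf.resolve_right h') ?_ o hoo ?_
      · rwa [contract_tgt_of_mem hb.tgt_mem]
      · rw [contract_arr_self hb.tgt_mem, contract_dep_of_mem (hXc h' _ h) h2]
  case ne_of_blob =>
    intro a ha h h1
    rcases hkB _ h with h | ⟨h, h'⟩
    · exact hB.ne_of_blob a ha (by rwa [hsrc]) (by rw [hsrc, htgt, h1])
    · exact (hB.subset ha).2 ⟨hXc h' _ h, hXc h' _ (h1.trans h)⟩
  case ent_mem =>
    intro y hy
    rcases hkB _ hy with h | ⟨rfl, h'⟩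
    · rw [he1 _ h]; exact hB.ent_mem y h
    · rw [he2 h']; exact hf.resolve_right h'
  case ent_tgt =>
    intro y hy
    rcases hkB _ hy with h | ⟨rfl, h'⟩
    · rw [he1 _ h, ← htgt]; exact hB.ent_tgt y h
    · rw [he2 h']; exact hkX _ hb.tgt_mem
  case reach =>
    intro v hv s
    rcases hkB _ hv with h | ⟨h, h'⟩
    · rw [he1 _ h]
      exact hB.reach_of_contract hF hb hkX hk h s
    · rw [h, he2 h']
      obtain ⟨Z, h1, h2, h3⟩ := hb.reach v (hXc h' v h) s
      exact ⟨Z, h1, h2, fun o ho => ⟨(h3 o ho).1, hkX _ (h3 o ho).2.1, hkX _ (h3 o ho).2.2⟩⟩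

/-- If there is no closed trail at the root, then there is a barrier. -/
theorem exists_barrier [Nonempty O] (S : DartSystem O V) {F : Set O} (hfin : F.Finite)
    (hF : ∀ o ∈ F, S.rev o ∈ F) {r : V}
    (hr : ∀ L, S.IsClosedWalk F r L → ¬ L.Pairwise S.Apart) :
    ∃ c blob A ent, S.IsBarrier F r c blob A ent := by
  induction hn : F.ncard using Nat.strong_induction_on generalizing S F with
  | _ n ih =>
    by_cases hw : ∃ L, S.IsClosedWalk F r L
    · obtain ⟨f, X, P, p, q, hb, hrX, ⟨o, ho, hoX⟩, hP, hp, hPpw, hPF⟩ := exists_blossom hF hr hw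
      have hsub : S.outer F X ⊆ F := fun o h => h.1
      have hout : ∀ o ∈ S.outer F X, S.rev o ∈ S.outer F X := fun o h =>
        ⟨hF _ h.1, fun hc => h.2 (inner_rev.1 hc)⟩
      -- The inner dart of the blossom makes the dart set shrink, and a closed trail at `r` after
      -- contraction would lift to one before.
      obtain ⟨c, blob, A, ent, hB⟩ := ih (S.outer F X).ncard
        (hn ▸ Set.ncard_lt_ncard ⟨hsub, fun h => (h ho).2 hoX⟩ hfin) (S.contract f X)
        (hfin.subset hsub) hout (by
          rintro L ⟨hne, hLF, p, q, hL, hp, hq⟩ hLpw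
          obtain ⟨M, hM, hMpw, hMF, L₁, Z, L₂, e, e', -⟩ :=
            hb.lift hF hL (hp ▸ hrX) (hq ▸ hrX) hLF hLpw
          refine hr M ⟨?_, hMF, p, q, hM, hp, hq⟩ hMpw
          rintro rfl
          apply hne
          simp only [List.nil_eq, List.append_eq_nil_iff] at e'
          simp [e, e'.1.1, e'.2]) rfl
      -- The stem survives contraction as a trail from `r`, so `f` is an arc or its end lies in a
      -- blob.
      obtain ⟨q', hP'⟩ := hP.contract (f := f) (X := X) fun o ho => (hPF o ho).2
      have hf := hB.of_trail hP' (fun o ho => ⟨(hPF o ho).1, fun hc => (hPF o ho).2 hc.1⟩) hPpw hp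
        f (by simp)
      rw [contract_tgt_of_mem hb.tgt_mem] at hf
      obtain ⟨c, blob, ent, h⟩ := hB.of_contract hF hb hrX (hf.imp_right fun ⟨h1, h2⟩ => by rwa [h2])
      exact ⟨c, blob, A, ent, h⟩
    · push Not at hw
      exact exists_barrier_of_no_closedWalk hF hw

end DartSystem

/-! ### Edge-disjoint walks in finite digraphs -/

namespace ArcFlow

variable {ε ν : Type*}

/-- `L` is a directed walk from `u` to `v` in the digraph with tails `t` and heads `h`. -/
def Walk (t h : ε → ν) (u : ν) : List ε → ν → Prop
  | [], v => u = v
  | a :: L, v => t a = u ∧ Walk t h (h a) L v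

lemma walk_append {t h : ε → ν} {u v : ν} {L M : List ε} :
    Walk t h u (L ++ M) v ↔ ∃ w, Walk t h u L w ∧ Walk t h w M v := by
  induction L generalizing u with
  | nil => simp [Walk]
  | cons a L ih => simp [Walk, ih, and_assoc]

lemma walk_append_cons {t h : ε → ν} {u v : ν} {L M : List ε} {a : ε} :
    Walk t h u (L ++ a :: M) v ↔ Walk t h u L (t a) ∧ Walk t h (h a) M v := by
  rw [walk_append]
  simp only [Walk]
  exact ⟨fun ⟨m, h1, h2, h3⟩ => ⟨h2 ▸ h1, h3⟩, fun ⟨h1, h2⟩ => ⟨_, h1, rfl, h2⟩⟩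

/-- In a shortest walk no head repeats, since the part between could be cut out. -/
lemma exists_walk_pairwise {t h : ε → ν} {A : Set ε} {u v : ν} {L : List ε}
    (hL : Walk t h u L v) (hA : ∀ a ∈ L, a ∈ A) :
    ∃ M, Walk t h u M v ∧ (∀ a ∈ M, a ∈ A) ∧ M.Pairwise fun a b => h a ≠ h b := by
  classical
  have hex : ∃ n, ∃ M, Walk t h u M v ∧ (∀ a ∈ M, a ∈ A) ∧ M.length = n := ⟨_, L, hL, hA, rfl⟩
  obtain ⟨M, hM, hMA, hn⟩ := Nat.find_spec hex
  refine ⟨M, hM, hMA, ?_⟩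
  by_contra hc
  obtain ⟨L₁, a, L₂, b, L₃, rfl, hab⟩ := List.exists_split_of_not_pairwise hc
  push Not at hab
  rw [walk_append_cons, walk_append_cons, ← hab] at hM
  have := Nat.find_min' hex ⟨L₁ ++ a :: L₃, walk_append_cons.2 ⟨hM.1, hM.2.2⟩, fun c hc => hMA c (by
    simp only [List.mem_append, List.mem_cons] at hc ⊢; tauto), rfl⟩
  rw [← hn] at this
  simp at this
  omega

open Classical in
/-- The contribution of an arc to the excess at `v`. -/
noncomputable def contrib (t h : ε → ν) (v : ν) (a : ε) : ℤ :=
  (if h a = v then 1 else 0) - (if t a = v then 1 else 0)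

/-- The excess at `v` of a set of arcs. -/
noncomputable def excess (t h : ε → ν) (F : Finset ε) (v : ν) : ℤ := ∑ a ∈ F, contrib t h v a

open Classical in
lemma Walk.sum_contrib {t h : ε → ν} {u w : ν} {L : List ε} (hL : Walk t h u L w) (v : ν) :
    (L.map (contrib t h v)).sum = (if w = v then 1 else 0) - (if u = v then 1 else 0) := by
  induction L generalizing u with
  | nil => simp [show u = w from hL]
  | cons a L ih =>
    rw [List.map_cons, List.sum_cons, ih hL.2, contrib, hL.1]
    ring

/-- A set of arcs that is balanced except at `r` and `x`. -/
def IsFlow (t h : ε → ν) (r x : ν) (F : Finset ε) : Prop :=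
  ∀ v, v ≠ r → v ≠ x → excess t h F v = 0

-- Summing the excess over `Y` leaves only the term at `x`, all other vertices of `Y` being
-- balanced.
open Classical in
lemma IsFlow.sum_cut {t h : ε → ν} {r x : ν} {F : Finset ε} (hF : IsFlow t h r x F) {Y : Set ν}
    (hx : x ∈ Y) (hr : r ∉ Y) :
    ∑ a ∈ F, ((if h a ∈ Y then 1 else 0) - (if t a ∈ Y then 1 else 0) : ℤ) = excess t h F x := by
  let N : Finset ν := (insert x (F.image t ∪ F.image h)).filter (· ∈ Y)
  have h1 : ∀ a ∈ F, ((if h a ∈ Y then 1 else 0) - (if t a ∈ Y then 1 else 0) : ℤ) =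
      ∑ v ∈ N, contrib t h v a := by
    intro a ha
    have e1 : h a ∈ N ↔ h a ∈ Y := by
      simp only [N, Finset.mem_filter, Finset.mem_insert, Finset.mem_union, Finset.mem_image]
      exact ⟨fun h => h.2, fun h => ⟨Or.inr (Or.inr ⟨a, ha, rfl⟩), h⟩⟩
    have e2 : t a ∈ N ↔ t a ∈ Y := by
      simp only [N, Finset.mem_filter, Finset.mem_insert, Finset.mem_union, Finset.mem_image]
      exact ⟨fun h => h.2, fun h => ⟨Or.inr (Or.inl ⟨a, ha, rfl⟩), h⟩⟩
    simp only [contrib, Finset.sum_sub_distrib, Finset.sum_ite_eq, e1, e2]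
  rw [Finset.sum_congr rfl h1, Finset.sum_comm]
  refine Finset.sum_eq_single_of_mem x (by simp [N, hx]) fun v hv hvx => hF v ?_ hvx
  rintro rfl
  exact hr (Finset.mem_filter.1 hv).2

/-- A flow of value `n` contains `n` edge-disjoint walks. -/
lemma IsFlow.exists_walks {t h : ε → ν} {r x : ν} (n : ℕ) {F : Finset ε}
    (hF : IsFlow t h r x F) (hrx : r ≠ x) (hn : excess t h F x = n) :
    ∃ Ps : List (List ε), Ps.length = n ∧ (∀ P ∈ Ps, Walk t h r P x ∧ P.Nodup ∧ ∀ a ∈ P, a ∈ F) ∧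
      Ps.Pairwise List.Disjoint := by
  classical
  induction n generalizing F with
  | zero => exact ⟨[], rfl, by simp, by simp⟩
  | succ n ih =>
    obtain ⟨L, hL, hLF, hpw⟩ : ∃ L, Walk t h r L x ∧ (∀ a ∈ L, a ∈ F) ∧
        L.Pairwise fun a b => h a ≠ h b := by
      by_contra hcon
      -- No arc of `F` enters the set of vertices from which `x` is reachable in `F`, so the excess
      -- at `x` would not be positive.
      let Y : Set ν := {v | ∃ L, Walk t h v L x ∧ ∀ a ∈ L, a ∈ F}
      have hr : r ∉ Y := fun ⟨L, hL, hLF⟩ =>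
        hcon (exists_walk_pairwise (A := (F : Set ε)) hL hLF)
      have h1 := hF.sum_cut (Y := Y) ⟨[], rfl, by simp⟩ hr
      have h2 : ∑ a ∈ F, ((if h a ∈ Y then 1 else 0) - (if t a ∈ Y then 1 else 0) : ℤ) ≤ 0 := by
        refine Finset.sum_nonpos fun a ha => ?_
        by_cases hY : h a ∈ Y
        · have : t a ∈ Y := by
            obtain ⟨L, hL, hLF⟩ := hY
            exact ⟨a :: L, ⟨rfl, hL⟩, by simpa [ha] using hLF⟩
          simp [hY, this]
        · split_ifs <;> simp
      rw [h1, hn] at h2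
      omega
    have hnd : L.Nodup := hpw.imp fun h e => h (by rw [e])
    have hex : ∀ v, excess t h (F \ L.toFinset) v =
        excess t h F v - ((if x = v then 1 else 0) - (if r = v then 1 else 0)) := fun v => by
      rw [← hL.sum_contrib v, ← List.sum_toFinset _ hnd, excess, excess,
        eq_sub_iff_add_eq, Finset.sum_sdiff]
      intro a ha
      exact hLF a (by simpa using ha)
    obtain ⟨Ps, hlen, hPs, hdis⟩ := ih (F := F \ L.toFinset)
      (fun v h1 h2 => by rw [hex, hF v h1 h2]; simp [h1.symm, h2.symm])
      (by rw [hex, hn]; simp [hrx])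
    refine ⟨L :: Ps, by simp [hlen], ?_, List.pairwise_cons.2 ⟨fun P hP a ha ha' => ?_, hdis⟩⟩
    · intro P hP
      rcases List.mem_cons.1 hP with rfl | hP
      · exact ⟨hL, hnd, hLF⟩
      · exact ⟨(hPs P hP).1, (hPs P hP).2.1, fun a ha => Finset.sdiff_subset ((hPs P hP).2.2 a ha)⟩
    · have := (hPs P hP).2.2 a ha'
      simp [ha] at this

/-- The tails of the arcs of the residual digraph. -/
def resTail (t h : ε → ν) (x : ε × Bool) : ν := if x.2 then t x.1 else h x.1

/-- The heads of the arcs of the residual digraph. -/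
def resHead (t h : ε → ν) (x : ε × Bool) : ν := if x.2 then h x.1 else t x.1

/-- Membership in `F` is flipped along `L`, one arc at a time; deleting an arc changes the excess
like adding its reverse. Distinctness keeps the flips independent. -/
lemma exists_augment {t h : ε → ν} {A F : Finset ε} (hFA : F ⊆ A) {L : List (ε × Bool)}
    (hL : ∀ x ∈ L, x.1 ∈ A ∧ (x.2 = true ↔ x.1 ∉ F)) (hpw : L.Pairwise fun x y => x.1 ≠ y.1) :
    ∃ F' ⊆ A, ∀ v, excess t h F' v =
      excess t h F v + (L.map (contrib (resTail t h) (resHead t h) v)).sum := by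
  classical
  induction L generalizing F with
  | nil => exact ⟨F, hFA, by simp⟩
  | cons x L ih =>
    rw [List.pairwise_cons] at hpw
    obtain ⟨a, b⟩ := x
    have ha := hL (a, b) (by simp)
    cases b with
    | true =>
      have haF : a ∉ F := ha.2.1 rfl
      obtain ⟨F', h1, h2⟩ := ih (F := insert a F) (Finset.insert_subset ha.1 hFA)
        (fun x hx => by
          have hne : x.1 ≠ a := (hpw.1 x hx).symm
          simpa [hne] using hL x (by simp [hx])) hpw.2
      refine ⟨F', h1, fun v => ?_⟩
      rw [h2, excess, Finset.sum_insert haF, List.map_cons, List.sum_cons]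
      simp only [contrib, resTail, resHead, excess, if_true]
      ring
    | false =>
      have haF : a ∈ F := by simpa using ha.2
      obtain ⟨F', h1, h2⟩ := ih (F := F.erase a) ((Finset.erase_subset _ _).trans hFA)
        (fun x hx => by
          have hne : x.1 ≠ a := (hpw.1 x hx).symm
          simpa [hne] using hL x (by simp [hx])) hpw.2
      refine ⟨F', h1, fun v => ?_⟩
      rw [h2, List.map_cons, List.sum_cons]
      have : excess t h F v = contrib t h v a + excess t h (F.erase a) v :=
        (Finset.add_sum_erase F _ haF).symm
      rw [this]
      simp only [contrib, resTail, resHead, Bool.false_eq_true, if_false]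
      ring

/-- The edge version of Menger's theorem for digraphs with finitely many arcs. -/
theorem menger (t h : ε → ν) (A : Finset ε) {r x : ν} (hrx : r ≠ x) :
    ∃ (Ps : List (List ε)) (Y : Set ν), (∀ P ∈ Ps, Walk t h r P x ∧ P.Nodup ∧ ∀ a ∈ P, a ∈ A) ∧
      Ps.Pairwise List.Disjoint ∧ x ∈ Y ∧ r ∉ Y ∧
      {a | a ∈ A ∧ t a ∉ Y ∧ h a ∈ Y}.ncard ≤ Ps.length := by
  classical
  obtain ⟨F, hF, hmax⟩ := Finset.exists_max_image (A.powerset.filter (IsFlow t h r x))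
    (fun F => excess t h F x) ⟨∅, by simp [IsFlow, excess]⟩
  rw [Finset.mem_filter, Finset.mem_powerset] at hF
  obtain ⟨hFA, hF⟩ := hF
  have hmax' : ∀ F' ⊆ A, IsFlow t h r x F' → excess t h F' x ≤ excess t h F x := fun F' h1 h2 =>
    hmax F' (by simp [h1, h2])
  have h0 : 0 ≤ excess t h F x := by
    have := hmax' ∅ (by simp) (by simp [IsFlow, excess])
    simpa [excess] using this
  obtain ⟨n, hn⟩ := Int.eq_ofNat_of_zero_le h0
  obtain ⟨Ps, hlen, hPs, hdis⟩ := hF.exists_walks n hrx hn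
  -- Residual arcs: arcs outside the flow forwards, arcs of the flow backwards.
  let R : Set (ε × Bool) := {y | y.1 ∈ A ∧ (y.2 = true ↔ y.1 ∉ F)}
  -- `Y` is the set of vertices not reachable from `r` in the residual digraph. All arcs of `A` into
  -- `Y` are in the flow and no flow arc leaves `Y`, so the cut size is the flow value.
  obtain ⟨Y, hY⟩ : ∃ Y : Set ν, ∀ v, v ∈ Y ↔
      ¬ ∃ L, Walk (resTail t h) (resHead t h) r L v ∧ ∀ y ∈ L, y ∈ R := ⟨{v | _}, fun v => Iff.rfl⟩
  have hstep : ∀ y ∈ R, resHead t h y ∈ Y → resTail t h y ∈ Y := by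
    intro y hy hh
    rw [hY] at hh ⊢
    rintro ⟨L, hL, hLR⟩
    refine hh ⟨L ++ [y], walk_append_cons.2 ⟨hL, rfl⟩, fun z hz => ?_⟩
    rcases List.mem_append.1 hz with hz | hz
    · exact hLR z hz
    · rw [List.mem_singleton.1 hz]; exact hy
  have hrY : r ∉ Y := fun hc => (hY r).1 hc ⟨[], rfl, by simp⟩
  have hxY : x ∈ Y := by
    rw [hY]
    rintro ⟨L, hL, hLR⟩
    obtain ⟨M, hM, hMR, hpw⟩ := exists_walk_pairwise hL hLR
    -- Membership in `F` fixes the direction of a residual arc, so distinct residual arcs lie over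
    -- distinct arcs.
    obtain ⟨F', hF', hex⟩ := exists_augment (t := t) (h := h) hFA hMR (hpw.imp_of_mem
      fun {a b} ha hb hab e => hab (by
        have h1 := (hMR a ha).2
        have h2 := (hMR b hb).2
        rw [e, ← h2] at h1
        rw [show a = b from Prod.ext e (Bool.eq_iff_iff.2 h1)]))
    simp only [hM.sum_contrib] at hex
    have h1 := hmax' F' hF' fun v hv1 hv2 => by
      rw [hex, hF v hv1 hv2]; simp [hv1.symm, hv2.symm]
    rw [hex] at h1
    simp [hrx] at h1
  refine ⟨Ps, Y, fun P hP => ⟨(hPs P hP).1, (hPs P hP).2.1, fun a ha => hFA ((hPs P hP).2.2 a ha)⟩,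
    hdis, hxY, hrY, ?_⟩
  have hcut := hF.sum_cut hxY hrY
  rw [hn] at hcut
  have hset : {a | a ∈ A ∧ t a ∉ Y ∧ h a ∈ Y} = ((F.filter fun a => t a ∉ Y ∧ h a ∈ Y : Finset ε) :
      Set ε) := by
    ext a
    simp only [Set.mem_ofPred_eq, Finset.coe_filter]
    refine ⟨fun ⟨ha, h1, h2⟩ => ⟨?_, h1, h2⟩, fun ⟨ha, h1⟩ => ⟨hFA ha, h1⟩⟩
    by_contra haF
    exact h1 (hstep (a, true) ⟨ha, by simp [haF]⟩ h2)
  have hsum : ∑ a ∈ F, ((if h a ∈ Y then 1 else 0) - (if t a ∈ Y then 1 else 0) : ℤ) =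
      ∑ a ∈ F, if t a ∉ Y ∧ h a ∈ Y then 1 else 0 := by
    refine Finset.sum_congr rfl fun a ha => ?_
    by_cases ht : t a ∈ Y
    · have : h a ∈ Y := hstep (a, false) ⟨hFA ha, by simp [ha]⟩ ht
      simp [ht, this]
    · simp [ht]
  rw [hset, Set.ncard_coe_finset, hlen]
  rw [hsum, Finset.sum_boole] at hcut
  exact_mod_cast hcut.le

end ArcFlow

/-! ### Lifting walks of the quotient digraph to trails -/

namespace DartSystem

variable {O V : Type*} {S : DartSystem O V}

section lift

variable {F : Set O} {r : V} {c : V → V} {blob : Set V} {A : Set O} {ent : V → O}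

variable (S) in
/-- The darts that the lift of the arc list `P` may use: its arcs, and the inner darts of the blobs
that it enters. -/
def Owned (c : V → V) (blob : Set V) (ent : V → O) (P : List O) (o : O) : Prop :=
  o ∈ P ∨ ∃ y ∈ blob, ent y ∈ P ∧ S.Inner {u | c u = y} o

lemma Owned.mono {P Q : List O} (h : P ⊆ Q) {o : O} (ho : S.Owned c blob ent P o) :
    S.Owned c blob ent Q o :=
  ho.imp (fun ho => h ho) fun ⟨y, h1, h2, h3⟩ => ⟨y, h1, h h2, h3⟩

lemma IsBarrier.not_inner (hB : S.IsBarrier F r c blob A ent) {y : V} (hy : y ∈ blob) {o : O}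
    (ho : o ∈ A) : ¬ S.Inner {u | c u = y} o := fun h =>
  hB.ne_of_blob o ho (by rw [show c (S.src o) = y from h.1]; exact hy) (h.2.trans h.1.symm)

/-- The inner darts of a blob belong to the walk containing its unique entrance, so disjoint walks
own disjoint blobs. Arcs are never inner to a blob, nor occur together with their reverses. -/
lemma IsBarrier.apart_of_owned (hB : S.IsBarrier F r c blob A ent) {P Q : List O}
    (hP : ∀ a ∈ P, a ∈ A) (hQ : ∀ a ∈ Q, a ∈ A) (hPQ : P.Disjoint Q) {a b : O}
    (ha : S.Owned c blob ent P a) (hb : S.Owned c blob ent Q b) : S.Apart a b := by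
  rcases ha with ha | ⟨y, hy, hyP, ha⟩
  · rcases hb with hb | ⟨y, hy, hyQ, hb⟩
    · refine ⟨?_, ?_⟩
      · rintro rfl
        exact hPQ ha hb
      · rintro rfl
        exact hB.rev_notMem b (hQ b hb) (hP _ ha)
    · exact (hb.apart (hB.not_inner hy (hP a ha))).symm
  · rcases hb with hb | ⟨z, hz, hzQ, hb⟩
    · exact ha.apart (hB.not_inner hy (hQ b hb))
    · refine ha.apart fun h => ?_
      have : y = z := (show c (S.src b) = y from h.1).symm.trans hb.1
      subst this
      exact hPQ hyP hzQ

lemma IsBarrier.exists_inner_trail (hB : S.IsBarrier F r c blob A ent) {a : O} (ha : a ∈ A)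
    (hb : c (S.tgt a) ∈ blob) {v : V} (s : ℤˣ) (e : c (S.tgt a) = c v) :
    ∃ Z, S.Path (S.arr a) Z (v, s) ∧ (a :: Z).Pairwise S.Apart ∧
      ∀ o ∈ a :: Z, o ∈ F ∧ S.Owned c blob ent [a] o := by
  have hea := hB.eq_ent a ha hb
  rw [e] at hb hea
  obtain ⟨Z, h1, h2, h3⟩ := hB.reach v hb s
  rw [← hea] at h1
  refine ⟨Z, h1, List.pairwise_cons.2 ⟨fun o ho => ((h3 o ho).2.apart
    (hB.not_inner hb ha)).symm, h2⟩, fun o ho => ?_⟩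
  rcases List.mem_cons.1 ho with rfl | ho
  · exact ⟨hB.subset ha, Or.inl (by simp)⟩
  · exact ⟨(h3 o ho).1, Or.inr ⟨c v, hb, by simp [← hea], (h3 o ho).2⟩⟩

/-- A walk along the arcs of a barrier lifts to a trail. -/
lemma IsBarrier.exists_lift (hB : S.IsBarrier F r c blob A ent) {x : V} {a : O} {P : List O}
    (hP : ArcFlow.Walk (fun o => c (S.src o)) (fun o => c (S.tgt o)) (c (S.tgt a)) P (c x))
    (hA : ∀ o ∈ a :: P, o ∈ A) (hnd : (a :: P).Nodup) :
    ∃ L q, S.Path (S.arr a) L q ∧ q.1 = x ∧ (a :: L).Pairwise S.Apart ∧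
      ∀ o ∈ a :: L, o ∈ F ∧ S.Owned c blob ent (a :: P) o := by
  induction P generalizing a with
  | nil =>
    have haA := hA a (by simp)
    have e : c (S.tgt a) = c x := hP
    by_cases hb : c (S.tgt a) ∈ blob
    · obtain ⟨Z, h1, h2, h3⟩ := hB.exists_inner_trail haA hb 1 e
      exact ⟨Z, _, h1, rfl, h2, h3⟩
    · exact ⟨[], _, rfl, hB.inj _ _ e hb, by simp, by simpa [Owned] using hB.subset haA⟩
  | cons b P ih =>
    have haA := hA a (by simp)
    have hbA := hA b (by simp)
    obtain ⟨e, hP⟩ := hP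
    have hA' : ∀ o ∈ b :: P, o ∈ A := fun o ho => hA o (List.mem_cons_of_mem _ ho)
    obtain ⟨L, q, hL, hq, hLpw, hLo⟩ := ih hP hA' hnd.of_cons
    have hmono : ∀ o, S.Owned c blob ent (b :: P) o → S.Owned c blob ent (a :: b :: P) o :=
      fun o ho => ho.mono (List.subset_cons_self _ _)
    have hap : ∀ o, S.Owned c blob ent [a] o → ∀ o' ∈ b :: L, S.Apart o o' := fun o ho o' ho' =>
      hB.apart_of_owned (by simpa using haA) hA' (by simpa using hnd.notMem) ho (hLo o' ho').2
    -- In a blob an inner trail joins the arrival of `a` to the departure of `b`; at a single vertex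
    -- the two states already agree.
    by_cases hb : c (S.tgt a) ∈ blob
    · obtain ⟨Z, h1, h2, h3⟩ := hB.exists_inner_trail haA hb (-S.sgn b) e.symm
      refine ⟨Z ++ b :: L, q, Path.append (m := S.dep b) h1 ⟨rfl, hL⟩, hq, ?_, ?_⟩
      · rw [← List.cons_append, List.pairwise_append]
        exact ⟨h2, hLpw, fun o ho => hap o (h3 o ho).2⟩
      · intro o ho
        rw [← List.cons_append] at ho
        rcases List.mem_append.1 ho with ho | ho
        · exact ⟨(h3 o ho).1, (h3 o ho).2.mono (by simp)⟩
        · exact ⟨(hLo o ho).1, hmono o (hLo o ho).2⟩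
    · have h := hB.arr_eq a haA b hbA (hB.inj _ _ e.symm hb) hb
      refine ⟨b :: L, q, ⟨h.symm, hL⟩, hq, List.pairwise_cons.2 ⟨hap a (Or.inl (by simp)), hLpw⟩, ?_⟩
      intro o ho
      rcases List.mem_cons.1 ho with rfl | ho
      · exact ⟨hB.subset haA, Or.inl (by simp)⟩
      · exact ⟨(hLo o ho).1, hmono o (hLo o ho).2⟩

end lift

/-- Menger's theorem for trails in finite dart systems without closed trails at the root. -/
theorem exists_trails_and_cut (S : DartSystem O V) {F : Set O} (hfin : F.Finite)
    (hF : ∀ o ∈ F, S.rev o ∈ F) {r x : V} (hxr : x ≠ r)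
    (hr : ∀ L, S.IsClosedWalk F r L → ¬ L.Pairwise S.Apart) :
    ∃ (Ls : List (List O)) (X : Set V) (C : Set O),
      (∀ L ∈ Ls, (∃ p q, S.Path p L q ∧ p.1 = r ∧ q.1 = x) ∧ L.Pairwise S.Apart) ∧
      Ls.Pairwise (fun L M => ∀ a ∈ L, ∀ b ∈ M, S.Apart a b) ∧ x ∈ X ∧ r ∉ X ∧
      C.Finite ∧ C.ncard ≤ Ls.length ∧
      ∀ p L q, S.Path p L q → p.1 = r → (∀ o ∈ L, o ∈ F) → L.Pairwise S.Apart →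
        ∀ o ∈ L, S.src o ∉ X → S.tgt o ∈ X → o ∈ C := by
  rcases isEmpty_or_nonempty O with hO | hO
  · exact ⟨[], {v | v ≠ r}, ∅, by simp, by simp, hxr, by simp, by simp, by simp,
      fun _ _ _ _ _ _ _ o => isEmptyElim o⟩
  obtain ⟨c, blob, A, ent, hB⟩ := S.exists_barrier hfin hF hr
  have hAfin : A.Finite := hfin.subset hB.subset
  have hcx : c r ≠ c x := fun h => hxr (hB.inj r x h hB.root_notMem).symm
  obtain ⟨Ps, Y, hPs, hdis, hxY, hrY, hcard⟩ := ArcFlow.menger (fun o => c (S.src o))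
    (fun o => c (S.tgt o)) hAfin.toFinset hcx
  simp only [Set.Finite.mem_toFinset] at hPs hcard
  have hlift : ∀ P ∈ Ps, ∃ L, (∃ p q, S.Path p L q ∧ p.1 = r ∧ q.1 = x) ∧ L.Pairwise S.Apart ∧
      ∀ o ∈ L, S.Owned c blob ent P o := by
    intro P hP
    obtain ⟨hw, hnd, hPA⟩ := hPs P hP
    cases P with
    | nil => exact absurd hw hcx
    | cons a P =>
      obtain ⟨e, hw⟩ := hw
      obtain ⟨L, q, h1, h2, h3, h4⟩ := hB.exists_lift hw hPA hnd
      exact ⟨a :: L, ⟨S.dep a, q, ⟨rfl, h1⟩, (hB.inj _ _ e.symm hB.root_notMem).symm, h2⟩, h3,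
        fun o ho => (h4 o ho).2⟩
  choose! g hg using hlift
  -- The cut is a union of classes, so a trail from `r` can enter it only along an arc of the
  -- quotient cut.
  refine ⟨Ps.map g, {v | c v ∈ Y}, {a | a ∈ A ∧ c (S.src a) ∉ Y ∧ c (S.tgt a) ∈ Y}, ?_, ?_, hxY,
    hrY, hAfin.subset fun a ha => ha.1, by simpa using hcard, ?_⟩
  · intro L hL
    obtain ⟨P, hP, rfl⟩ := List.mem_map.1 hL
    exact ⟨(hg P hP).1, (hg P hP).2.1⟩
  · rw [List.pairwise_map]
    exact hdis.imp_of_mem fun {P Q} hP hQ hPQ a ha b hb =>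
      hB.apart_of_owned (hPs P hP).2.2 (hPs Q hQ).2.2 hPQ ((hg P hP).2.2 a ha) ((hg Q hQ).2.2 b hb)
  · intro p L q hL hp hLF hpw o ho h1 h2
    rcases hB.of_trail hL hLF hpw hp o ho with h | ⟨-, h⟩
    · exact ⟨h, h1, h2⟩
    · exact absurd (show c (S.src o) ∈ Y from h ▸ h2) h1

lemma Path.exists_mem_entering {p q : V × ℤˣ} {L : List O} (h : S.Path p L q) {X : Set V}
    (hp : p.1 ∉ X) (hq : q.1 ∈ X) : ∃ o ∈ L, S.src o ∉ X ∧ S.tgt o ∈ X := by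
  induction L generalizing p with
  | nil => exact absurd (path_nil.1 h ▸ hq) hp
  | cons o L ih =>
    obtain ⟨rfl, h⟩ := h
    by_cases ho : S.tgt o ∈ X
    · exact ⟨o, by simp, hp, ho⟩
    · obtain ⟨a, ha, h'⟩ := ih h ho
      exact ⟨a, by simp [ha], h'⟩

end DartSystem

theorem List.exists_first_split {α : Type*} {p : α → Prop} {l : List α} (h : ∃ a ∈ l, p a) :
    ∃ l₁ a l₂, l = l₁ ++ a :: l₂ ∧ p a ∧ ∀ b ∈ l₁, ¬ p b := by
  induction l with
  | nil => simp at h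
  | cons a l ih =>
    by_cases ha : p a
    · exact ⟨[], a, l, rfl, ha, by simp⟩
    · obtain ⟨l₁, b, l₂, rfl, hb, h'⟩ := ih (by simpa [ha] using h)
      exact ⟨a :: l₁, b, l₂, rfl, hb, by simpa [ha] using h'⟩

/-! ### Bidirected graphs as dart systems -/

namespace BidirectedGraph

variable {α β : Type*} {B : BidirectedGraph α β}

/-- The opposite orientation of an oriented edge. -/
def OrientedEdge.reverse (o : B.OrientedEdge) : B.OrientedEdge :=
  ⟨o.edge, o.head, o.tail, o.isLink.symm⟩

variable (B) in
/-- The dart system of a bidirected graph. -/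
def darts : DartSystem B.OrientedEdge α where
  rev := OrientedEdge.reverse
  rev_rev _ := rfl
  src := OrientedEdge.tail
  sgn := OrientedEdge.tailSign

lemma OrientedEdge.edge_eq_iff {a b : B.OrientedEdge} :
    a.edge = b.edge ↔ a = b ∨ a = b.reverse := by
  constructor
  · intro h
    have := a.isLink
    rw [h] at this
    rcases this.eq_and_eq_or_eq_and_eq b.isLink with ⟨h1, h2⟩ | ⟨h1, h2⟩
    · exact Or.inl (OrientedEdge.ext h h1 h2)
    · exact Or.inr (OrientedEdge.ext h h1 h2)
  · rintro (rfl | rfl) <;> rfl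

lemma apart_iff {a b : B.OrientedEdge} : B.darts.Apart a b ↔ a.edge ≠ b.edge := by
  rw [ne_eq, OrientedEdge.edge_eq_iff, not_or]
  rfl

lemma reverse_ne (o : B.OrientedEdge) : o.reverse ≠ o := fun h => by
  have := B.loopless
  exact o.isLink.ne (congrArg OrientedEdge.head h)

lemma arr_eq_dep_iff {a b : B.OrientedEdge} :
    B.darts.dep b = B.darts.arr a ↔ b.tail = a.head ∧ b.tailSign = -a.headSign := by
  change (b.tail, -b.tailSign) = (a.head, a.headSign) ↔ _
  rw [Prod.mk.injEq, neg_eq_iff_eq_neg]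

lemma path_of_isChain {o : B.OrientedEdge} {L : List B.OrientedEdge}
    (h : (o :: L).IsChain fun e f => f.tail = e.head ∧ f.tailSign = -e.headSign) :
    ∃ q, B.darts.Path (B.darts.arr o) L q ∧
      q.1 = (((o :: L).getLast?.map OrientedEdge.head).getD o.tail) := by
  induction L generalizing o with
  | nil => exact ⟨_, rfl, rfl⟩
  | cons b L ih =>
    rw [List.isChain_cons_cons] at h
    obtain ⟨q, h1, h2⟩ := ih h.2
    refine ⟨q, ⟨arr_eq_dep_iff.2 h.1, h1⟩, h2.trans ?_⟩
    simp [List.getLast?_cons]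

lemma isChain_of_path {p q : α × ℤˣ} {L : List B.OrientedEdge} (h : B.darts.Path p L q) :
    L.IsChain (fun e f => f.tail = e.head ∧ f.tailSign = -e.headSign) ∧
      (∀ e ∈ L.head?, e.tail = p.1) ∧ (L.getLast?.map OrientedEdge.head).getD p.1 = q.1 := by
  induction L generalizing p with
  | nil => simp [DartSystem.path_nil.1 h]
  | cons o L ih =>
    obtain ⟨rfl, h⟩ := h
    obtain ⟨h1, h2, h3⟩ := ih h
    refine ⟨?_, by simp [darts], ?_⟩
    · cases L with
      | nil => simp
      | cons b L => exact List.isChain_cons_cons.2 ⟨arr_eq_dep_iff.1 h.1, h1⟩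
    · rw [← h3]
      cases L with
      | nil => rfl
      | cons b L => simp [List.getLast?_cons]

lemma Trail.exists_path (T : B.Trail) :
    (∃ p q, B.darts.Path p T.edges q ∧ p.1 = T.init ∧ q.1 = T.term) ∧
      T.edges.Pairwise B.darts.Apart := by
  constructor
  · have hc := T.chain
    have ht := T.tail_first
    have hterm : T.term = (T.edges.getLast?.map OrientedEdge.head).getD T.init := rfl
    cases hE : T.edges with
    | nil => exact ⟨(T.init, 1), _, rfl, rfl, by rw [hterm, hE]; rfl⟩
    | cons o L =>
      rw [hE] at hc ht
      have h0 : o.tail = T.init := ht o (by simp)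
      obtain ⟨q, h1, h2⟩ := path_of_isChain hc
      exact ⟨B.darts.dep o, q, ⟨rfl, h1⟩, h0, by rw [h2, hterm, hE, h0]⟩
  · exact (List.pairwise_map.1 T.nodup).imp fun h => apart_iff.2 h

lemma exists_trail_of_path {p q : α × ℤˣ} {L : List B.OrientedEdge} (h : B.darts.Path p L q)
    (hpw : L.Pairwise B.darts.Apart) (hp : p.1 ∈ B.graph.vertexSet) :
    ∃ T : B.Trail, T.edges = L ∧ T.IsFromTo p.1 q.1 := by
  obtain ⟨h1, h2, h3⟩ := isChain_of_path h
  exact ⟨⟨p.1, hp, L, h2, h1, List.pairwise_map.2 (hpw.imp fun h => apart_iff.1 h)⟩, rfl, rfl, h3⟩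

/-- In an edge-clean graph no trail returns to the root. -/
lemma EdgeClean.tgt_ne {r : α} (hB : B.EdgeClean r) (hr : r ∈ B.graph.vertexSet) {p q : α × ℤˣ}
    {L : List B.OrientedEdge} (h : B.darts.Path p L q) (hpw : L.Pairwise B.darts.Apart)
    (hp : p.1 = r) : ∀ o ∈ L, o.head ≠ r := by
  by_contra hc
  push Not at hc
  -- At the first return to `r`, the initial segment reaches `o`, while the reverse of `o` alone is
  -- an `r`-trail. Both orientations are thus reachable.
  obtain ⟨L₁, o, L₂, rfl, ho, hL₁⟩ := List.exists_first_split hc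
  have e : L₁ ++ o :: L₂ = (L₁ ++ [o]) ++ L₂ := by simp
  rw [e] at h hpw
  obtain ⟨m, h1, -⟩ := DartSystem.path_append.1 h
  obtain ⟨T, hT, hT'⟩ := exists_trail_of_path h1 (List.pairwise_append.1 hpw).1 (hp ▸ hr)
  have hreach : B.TrailReaches r o := ⟨T, ⟨hT'.1.trans hp, by simpa [hT] using hL₁⟩, by simp [hT]⟩
  obtain ⟨T', hT₁, hT₂⟩ := exists_trail_of_path (B := B) (L := [o.reverse])
    (p := B.darts.dep o.reverse) ⟨rfl, rfl⟩ (by simp) (by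
      change o.head ∈ _
      rwa [ho])
  have hreach' : B.TrailReaches r o.reverse :=
    ⟨T', ⟨hT₂.1.trans ho, by simp [hT₁]⟩, by simp [hT₁]⟩
  obtain ⟨_, -, hu⟩ := hB o.edge (ho ▸ o.isLink.inc_right)
  exact reverse_ne o ((hu o.reverse ⟨rfl, hreach'⟩).trans (hu o ⟨rfl, hreach⟩).symm)

/-- Since the trail never returns to `r`, its initial segment up to `o` is an `r`-trail. -/
lemma EdgeClean.trailReaches {r : α} (hB : B.EdgeClean r) {T : B.Trail} (hT : T.init = r)
    {o : B.OrientedEdge} (ho : o ∈ T.edges) : B.TrailReaches r o := by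
  obtain ⟨⟨p, q, hp, hpi, -⟩, hpw⟩ := T.exists_path
  have hr : r ∈ B.graph.vertexSet := hT ▸ T.init_mem
  have hne := hB.tgt_ne hr hp hpw (hpi.trans hT)
  obtain ⟨L₁, L₂, e⟩ := List.append_of_mem ho
  have e' : T.edges = (L₁ ++ [o]) ++ L₂ := by simp [e]
  rw [e'] at hp hpw hne
  obtain ⟨m, h1, -⟩ := DartSystem.path_append.1 hp
  obtain ⟨T', hT₁, hT₂⟩ := exists_trail_of_path h1 (List.pairwise_append.1 hpw).1
    (by rw [hpi]; exact T.init_mem)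
  exact ⟨T', ⟨hT₂.1.trans (hpi.trans hT), fun a ha => hne a (by
    have : a ∈ L₁ := by simpa [hT₁] using ha
    simp [this])⟩, by simp [hT₁]⟩

/-- Disjoint trails are no more numerous than the edges of a trail cut. -/
lemma EdgeClean.encard_le {r x : α} (hB : B.EdgeClean r) {𝒯 : Set B.Trail}
    (h𝒯 : B.IsEdgeDisjointTrails r x 𝒯) {X : Set α} (hr : r ∉ X) (hx : x ∈ X) :
    𝒯.encard ≤ (B.trailCut r X).encard := by
  have hex : ∀ T ∈ 𝒯, ∃ e, e ∈ B.trailCut r X ∧ e ∈ T.edgeSet := by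
    intro T hT
    obtain ⟨h1, h2⟩ := h𝒯.1 T hT
    obtain ⟨⟨p, q, hp, hpi, hq⟩, hpw⟩ := T.exists_path
    obtain ⟨o, ho, h3, h4⟩ := hp.exists_mem_entering (X := X) (by rwa [hpi, h1]) (by rwa [hq, h2])
    exact ⟨o.edge, ⟨o, rfl, h4, h3, hB.trailReaches h1 ho⟩, o, ho, rfl⟩
  rcases 𝒯.eq_empty_or_nonempty with rfl | ⟨T₀, hT₀⟩
  · simp
  have : Nonempty β := ⟨(hex T₀ hT₀).choose⟩
  choose! g hg using hex
  refine Set.encard_le_encard_of_injOn (f := g) (fun T hT => (hg T hT).1) fun S hS T hT e => ?_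
  by_contra hne
  exact Set.disjoint_left.1 (h𝒯.2 hS hT hne) (hg S hS).2 (e ▸ (hg T hT).2)

lemma Trail.edges_ne_nil {T : B.Trail} {r x : α} (h : T.IsFromTo r x) (hxr : x ≠ r) :
    T.edges ≠ [] := by
  intro he
  apply hxr
  rw [← h.1, ← h.2, Trail.term, he]
  rfl

lemma finite_darts (G : Finset β) : {o : B.OrientedEdge | o.edge ∈ G}.Finite := by
  have : {o : B.OrientedEdge | o.edge ∈ G} = ⋃ e ∈ G, {o | o.edge = e} := by ext; simp
  rw [this]
  refine Set.Finite.biUnion G.finite_toSet fun e _ => ?_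
  by_cases h : ∃ o : B.OrientedEdge, o.edge = e
  · obtain ⟨o, rfl⟩ := h
    exact (Set.toFinite {o, o.reverse}).subset fun a ha => OrientedEdge.edge_eq_iff.1 ha
  · convert Set.finite_empty
    ext o
    simpa using fun ho => h ⟨o, ho⟩

/-- For every finite edge set there are as many disjoint trails as oriented edges with which
trails in that edge set can enter a suitable vertex set. -/
lemma EdgeClean.exists_finite {r x : α} (hB : B.EdgeClean r) (hr : r ∈ B.graph.vertexSet)
    (hx : x ∈ B.graph.vertexSet) (hxr : x ≠ r) (G : Finset β) :
    ∃ (𝒯 : Set B.Trail) (k : ℕ) (X : Set α) (C : Set B.OrientedEdge),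
      B.IsEdgeDisjointTrails r x 𝒯 ∧ 𝒯.encard = k ∧ X ⊆ B.graph.vertexSet \ {r} ∧ x ∈ X ∧
      C.encard ≤ k ∧ ∀ T : B.Trail, T.init = r → T.edgeSet ⊆ G →
        ∀ o ∈ T.edges, o.tail ∉ X → o.head ∈ X → o ∈ C := by
  obtain ⟨Ls, X, C, hLs, hdis, hxX, hrX, hCf, hC, hcut⟩ := B.darts.exists_trails_and_cut
    (finite_darts G) (fun o ho => ho) hxr (r := r) (by
      rintro L ⟨hne, -, p, q, hL, hp, hq⟩ hpw
      obtain ⟨L, o, rfl⟩ := (List.eq_nil_or_concat' L).resolve_left hne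
      refine hB.tgt_ne hr hL hpw hp o (by simp) ?_
      rw [DartSystem.path_append_cons] at hL
      rw [← hq, ← DartSystem.path_nil.1 hL.2]
      rfl)
  have hex : ∀ L ∈ Ls, ∃ T : B.Trail, T.edges = L ∧ T.IsFromTo r x := by
    intro L hL
    obtain ⟨⟨p, q, h, rfl, rfl⟩, hpw⟩ := hLs L hL
    exact exists_trail_of_path h hpw hr
  have : Nonempty B.Trail := ⟨⟨r, hr, [], by simp, by simp, by simp⟩⟩
  choose! g hg using hex
  have hnd : Ls.Nodup := hdis.imp_of_mem fun {L M} hL _ h e => by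
    subst e
    have hne := Trail.edges_ne_nil (hg L hL).2 hxr
    rw [(hg L hL).1] at hne
    obtain ⟨a, ha⟩ := List.exists_mem_of_ne_nil _ hne
    exact (h a ha a ha).1 rfl
  -- Intersecting with the vertex set creates no new entries, because tails of oriented edges are
  -- vertices.
  refine ⟨g '' {L | L ∈ Ls}, Ls.length, X ∩ B.graph.vertexSet, C, ⟨?_, ?_⟩, ?_,
    fun v hv => ⟨hv.2, fun h => hrX (h ▸ hv.1)⟩, ⟨hxX, hx⟩, ?_, ?_⟩
  · rintro _ ⟨L, hL, rfl⟩
    exact (hg L hL).2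
  · rintro _ ⟨L, hL, rfl⟩ _ ⟨M, hM, rfl⟩ hne
    have : Std.Symm fun L M : List B.OrientedEdge => ∀ a ∈ L, ∀ b ∈ M, B.darts.Apart a b :=
      ⟨fun L M h a ha b hb => (h b hb a ha).symm⟩
    have hLM : ∀ a ∈ L, ∀ b ∈ M, B.darts.Apart a b :=
      hdis.forall hL hM fun e => hne (by rw [e])
    rw [Set.disjoint_left]
    rintro e ⟨a, ha, rfl⟩ ⟨b, hb, hab⟩
    rw [(hg L hL).1] at ha
    rw [(hg M hM).1] at hb
    exact apart_iff.1 (hLM a ha b hb) hab.symm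
  · classical
    have hinj : Set.InjOn g {L | L ∈ Ls} := fun L hL M hM e => by
      rw [← (hg L hL).1, ← (hg M hM).1, e]
    rw [hinj.encard_image, show {L | L ∈ Ls} = (Ls.toFinset : Set _) by ext; simp,
      Set.encard_coe_eq_coe_finsetCard, List.toFinset_card_of_nodup hnd]
  · rw [← hCf.cast_ncard_eq]
    exact_mod_cast hC
  · intro T hT hTG o ho h1 h2
    obtain ⟨⟨p, q, hp, hpi, -⟩, hpw⟩ := T.exists_path
    exact hcut p _ q hp (hpi.trans hT) (fun a ha => hTG ⟨a, ha, rfl⟩) hpw o ho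
      (fun h => h1 ⟨h, o.isLink.left_mem⟩) h2.1

/-! ### From finite edge sets to infinite graphs -/

/-- If the sizes of disjoint trail families are bounded by `n`, then some trail cut has at most `n`
edges. -/
lemma EdgeClean.exists_cut {r x : α} (hB : B.EdgeClean r) (hr : r ∈ B.graph.vertexSet)
    (hx : x ∈ B.graph.vertexSet) (hxr : x ≠ r) {n : ℕ}
    (hn : ∀ 𝒯, B.IsEdgeDisjointTrails r x 𝒯 → 𝒯.encard ≤ n) :
    ∃ X : Set α, X ⊆ B.graph.vertexSet \ {r} ∧ x ∈ X ∧ (B.trailCut r X).encard ≤ n := by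
  classical
  choose 𝒯 k X C h𝒯 hk hX hxX hC hcut using hB.exists_finite hr hx hxr
  -- The cut is the limit of the sets `X G` along an ultrafilter containing all sets of the form `{G
  -- | G₀ ⊆ G}`.
  let U : Ultrafilter (Finset β) := Ultrafilter.of Filter.atTop
  refine ⟨{v | ∀ᶠ G in U, v ∈ X G}, fun v hv => ?_, Filter.Eventually.of_forall hxX, ?_⟩
  · obtain ⟨G, hG⟩ := Filter.Eventually.exists hv
    exact hX G hG
  by_contra hlt
  rw [not_le] at hlt
  obtain ⟨D, hD, hDn⟩ := Set.exists_subset_encard_eq (Order.add_one_le_of_lt hlt)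
  have hDfin : D.Finite := by
    rw [← Set.encard_ne_top_iff, hDn]
    exact ENat.natCast_ne_top (n + 1)
  have : Nonempty B.OrientedEdge := by
    obtain ⟨e, he⟩ := Set.nonempty_of_encard_ne_zero (s := D) (by rw [hDn]; simp)
    exact ⟨(hD he).choose⟩
  have hex : ∀ e ∈ D, ∃ o : B.OrientedEdge, o.edge = e ∧ (∀ᶠ G in U, o.head ∈ X G) ∧
      (¬ ∀ᶠ G in U, o.tail ∈ X G) ∧ B.TrailReaches r o := fun e he => hD he
  choose! o ho1 ho2 ho3 ho4 using hex
  -- For almost all `G`, the trails witnessing these `n + 1` cut edges lie in `G`, and their last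
  -- edges enter `X G`. A single such `G` contradicts the bound on `C G`.
  have hev : ∀ᶠ G in (U : Filter (Finset β)), ∀ e ∈ D, o e ∈ C G := by
    rw [Filter.eventually_all_finite hDfin]
    intro e he
    obtain ⟨T, hT, hTo⟩ := ho4 e he
    have h1 : ∀ᶠ G in (U : Filter (Finset β)), (o e).tail ∉ X G :=
      Ultrafilter.eventually_not.2 (ho3 e he)
    have h2 : ∀ᶠ G : Finset β in U, T.edgeSet ⊆ G := by
      refine Ultrafilter.of_le Filter.atTop (Filter.eventually_atTop.2
        ⟨(T.edges.map OrientedEdge.edge).toFinset, fun G hG e' he' => hG ?_⟩)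
      simpa [Trail.edgeSet] using he'
    filter_upwards [h1, h2, ho2 e he] with G h1 h2 h3
    exact hcut G T hT.1 h2 _ (List.mem_of_getLast? hTo) h1 h3
  obtain ⟨G, hG⟩ := hev.exists
  have hle : D.encard ≤ (C G).encard := Set.encard_le_encard_of_injOn (f := o) hG
    fun a ha b hb e => by rw [← ho1 a ha, ← ho1 b hb, e]
  have : (n : ℕ∞) + 1 ≤ n := by
    rw [← hDn]
    exact hle.trans ((hC G).trans ((hk G).symm.le.trans (hn _ (h𝒯 G))))
  have h' : ((n + 1 : ℕ) : ℕ∞) ≤ n := this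
  rw [Nat.cast_le] at h'
  omega

/-- If there are arbitrarily large finite families of disjoint trails, then there is an
infinite one. -/
lemma exists_infinite_trails {r x : α} (hxr : x ≠ r)
    (h : ∀ n : ℕ, ∃ 𝒯, B.IsEdgeDisjointTrails r x 𝒯 ∧ (n : ℕ∞) < 𝒯.encard) :
    ∃ 𝒯, B.IsEdgeDisjointTrails r x 𝒯 ∧ 𝒯.encard = ⊤ := by
  classical
  obtain ⟨𝒯, h𝒯⟩ := zorn_subset {𝒯 | B.IsEdgeDisjointTrails r x 𝒯} (by
    intro c hc hch
    refine ⟨⋃₀ c, ⟨?_, ?_⟩, fun s hs => Set.subset_sUnion_of_mem hs⟩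
    · rintro T ⟨s, hs, hT⟩
      exact (hc hs).1 T hT
    · exact (Set.pairwise_sUnion hch.directedOn).2 fun s hs => (hc hs).2)
  refine ⟨𝒯, h𝒯.prop, ?_⟩
  by_contra hfin
  rw [← ne_eq, Set.encard_ne_top_iff] at hfin
  let E : Set β := ⋃ T ∈ 𝒯, T.edgeSet
  have hE : E.Finite := hfin.biUnion fun T _ => by
    refine (T.edges.map OrientedEdge.edge).toFinset.finite_toSet.subset fun e he => ?_
    simpa [Trail.edgeSet] using he
  -- With more disjoint trails than edges in `E`, one of them avoids `E`, against maximality.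
  obtain ⟨𝒮, h𝒮, hlt⟩ := h E.ncard
  rw [hE.cast_ncard_eq] at hlt
  obtain ⟨T, hT, hTE⟩ : ∃ T ∈ 𝒮, Disjoint T.edgeSet E := by
    by_contra hc
    push Not at hc
    simp only [Set.not_disjoint_iff] at hc
    rcases 𝒮.eq_empty_or_nonempty with rfl | ⟨T₀, hT₀⟩
    · simp at hlt
    have : Nonempty β := ⟨(hc T₀ hT₀).choose⟩
    choose! g hg using hc
    refine hlt.not_ge (Set.encard_le_encard_of_injOn (f := g) (fun T hT => (hg T hT).2)
      fun S hS T hT e => ?_)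
    by_contra hne
    exact Set.disjoint_left.1 (h𝒮.2 hS hT hne) (hg S hS).1 (e ▸ (hg T hT).1)
  have hdis : ∀ S ∈ 𝒯, Disjoint T.edgeSet S.edgeSet := fun S hS =>
    hTE.mono_right (Set.subset_biUnion_of_mem (u := fun T : B.Trail => T.edgeSet) hS)
  have hins : B.IsEdgeDisjointTrails r x (insert T 𝒯) := by
    refine ⟨?_, ?_⟩
    · rintro S (rfl | hS)
      exacts [h𝒮.1 _ hT, h𝒯.prop.1 S hS]
    · exact h𝒯.prop.2.insert fun S hS _ => ⟨hdis S hS, (hdis S hS).symm⟩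
  have hT𝒯 : T ∈ 𝒯 := h𝒯.le_of_ge hins (Set.subset_insert _ _) (Set.mem_insert _ _)
  obtain ⟨a, ha⟩ := List.exists_mem_of_ne_nil _ (Trail.edges_ne_nil (h𝒮.1 T hT) hxr)
  exact Set.disjoint_left.1 (hdis T hT𝒯) ⟨a, ha, rfl⟩ ⟨a, ha, rfl⟩

end BidirectedGraph

theorem mainTheorem2 {α β : Type*} (B : BidirectedGraph α β) (r x : α)
    (hr : r ∈ B.graph.vertexSet) (hx : x ∈ B.graph.vertexSet) (hxr : x ≠ r)
    (hB : B.EdgeClean r) :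
    ∃ n : ℕ∞,
      IsGreatest {k : ℕ∞ | ∃ 𝒯 : Set B.Trail, B.IsEdgeDisjointTrails r x 𝒯 ∧ 𝒯.encard = k} n ∧
      IsLeast {k : ℕ∞ | ∃ X : Set α, X ⊆ B.graph.vertexSet \ {r} ∧ x ∈ X ∧
        (B.trailCut r X).encard = k} n := by
  classical
  have hle : ∀ 𝒯, B.IsEdgeDisjointTrails r x 𝒯 → ∀ X : Set α, X ⊆ B.graph.vertexSet \ {r} → x ∈ X →
      𝒯.encard ≤ (B.trailCut r X).encard := fun 𝒯 h𝒯 X hX hxX =>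
    hB.encard_le h𝒯 (fun h => (hX h).2 rfl) hxX
  suffices ∃ 𝒯 X, B.IsEdgeDisjointTrails r x 𝒯 ∧ X ⊆ B.graph.vertexSet \ {r} ∧ x ∈ X ∧
      (B.trailCut r X).encard ≤ 𝒯.encard by
    obtain ⟨𝒯, X, h𝒯, hX, hxX, h⟩ := this
    refine ⟨𝒯.encard, ⟨⟨𝒯, h𝒯, rfl⟩, ?_⟩, ⟨⟨X, hX, hxX, h.antisymm (hle 𝒯 h𝒯 X hX hxX)⟩, ?_⟩⟩
    · rintro _ ⟨𝒮, h𝒮, rfl⟩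
      exact (hle 𝒮 h𝒮 X hX hxX).trans h
    · rintro _ ⟨Y, hY, hxY, rfl⟩
      exact hle 𝒯 h𝒯 Y hY hxY
  by_cases hb : ∃ n : ℕ, ∀ 𝒯, B.IsEdgeDisjointTrails r x 𝒯 → 𝒯.encard ≤ n
  · have hn := Nat.find_spec hb
    obtain ⟨X, hX, hxX, hcut⟩ := hB.exists_cut hr hx hxr hn
    -- The least bound is attained, for otherwise its predecessor would be a bound; for `0` the
    -- empty family suffices.
    obtain ⟨𝒯, h𝒯, hge⟩ : ∃ 𝒯, B.IsEdgeDisjointTrails r x 𝒯 ∧ (Nat.find hb : ℕ∞) ≤ 𝒯.encard := by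
      by_contra hc
      push Not at hc
      rcases hm : Nat.find hb with _ | m
      · have := hc ∅ ⟨by simp, by simp⟩
        rw [hm] at this
        simp at this
      · refine Nat.find_min hb (m := m) (by omega) fun 𝒯 h𝒯 => ?_
        have := hc 𝒯 h𝒯
        rw [hm] at this
        exact Order.le_of_lt_add_one this
    exact ⟨𝒯, X, h𝒯, hX, hxX, hcut.trans hge⟩
  · push Not at hb
    obtain ⟨𝒯, h𝒯, htop⟩ := BidirectedGraph.exists_infinite_trails hxr hb
    -- Any admissible set serves as the cut, the family being infinite.
    exact ⟨𝒯, B.graph.vertexSet \ {r}, h𝒯, subset_rfl, ⟨hx, hxr⟩, by rw [htop]; exact le_top⟩
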